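/- Let $n\ge 2$ and let $\mathbb S^n\subset\mathbb R^{n+1}$ be the unit sphere with its standard metric $g$ induced from $\mathbb R^{n+1}$, with coordinate functions $x_1,\dots,x_{n+1}$ and north pole $N=(0,\dots,0,1)$. A smooth domain in $\mathbb S^n$ is a pair $(\Omega,\Sigma)$, where $\Omega\subset\mathbb S^n$ is a nonempty connected open set whose boundary $\Sigma=\partial\Omega$ is a smooth hypersurface with $\Omega$ locally on one side of it. Let $\nu$ be the outward unit normal to $\Sigma$, $\hat g$ the induced metric on $\Sigma$, and $h(X,Y)=-\langle\nu,D_XY\rangle$ the second fundamental form. Let $\ker\Phi^*$ be the space of all $u\in C^\infty(\overline\Omega)$ with $$-(\Delta u)\,g+\operatorname{Hess}u-u\operatorname{Ric}=0\ \text{ in }\Omega,\qquad u_\nu\,\hat g=u\,h\ \text{ on }\Sigma .$$ The smooth domain $(\Omega,\Sigma)$ is called non-generic if $\ker\Phi^*\neq 0$, and a non-generic domain is called simple if $\Sigma$ has exactly one connected component. A spherical cap is a set of the form $\{x\in\mathbb S^n:\angle(p,x)<\theta\}$ with center $p\in\mathbb S^n$ and $\theta\in(0,\pi)$. Then: 1.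 every spherical cap (with its boundary) is a non-generic domain in $\mathbb S^n$; 2. if the cap is centered at the north pole $N$, then $\ker\Phi^*=\operatorname{span}\{x_1,\dots,x_n\}$ (as functions on $\overline\Omega$); 3. the simple non-generic domains in $\mathbb S^n$ are exactly the spherical caps. -/

import Mathlib

open scoped Manifold ContDiff Topology
open Bundle

noncomputable section

namespace StaticDomain

/-! ### Riemannian geometry in coordinates

`G` is the matrix `(g_ij)` of the components of a Riemannian metric, as a function of the
coordinates `y`. -/

section Coordinates

variable {n : ℕ}

/-- The `i`-th coordinate vector of `ℝⁿ`. -/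
abbrev basisVec (i : Fin n) : EuclideanSpace ℝ (Fin n) := EuclideanSpace.single i 1

/-- The `i`-th partial derivative of `f` at `y`. -/
def partialDeriv (i : Fin n) (f : EuclideanSpace ℝ (Fin n) → ℝ)
    (y : EuclideanSpace ℝ (Fin n)) : ℝ :=
  fderiv ℝ f y (basisVec i)

/-- The Christoffel symbol
`Γᵏ_ij = ½ ∑ₗ gᵏˡ (∂_i g_jl + ∂_j g_il - ∂_l g_ij)` of the Levi-Civita connection. -/
def christoffel (G : EuclideanSpace ℝ (Fin n) → Matrix (Fin n) (Fin n) ℝ)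
    (k i j : Fin n) (y : EuclideanSpace ℝ (Fin n)) : ℝ :=
  (1 / 2) * ∑ l, (G y)⁻¹ k l *
    (partialDeriv i (fun z => G z j l) y + partialDeriv j (fun z => G z i l) y
      - partialDeriv l (fun z => G z i j) y)

/-- The component `R^l_{kij}` of the curvature tensor, `R(∂_i, ∂_j) ∂_k = ∑ₗ R^l_{kij} ∂_l`, where
`R(X, Y) Z = D_X D_Y Z - D_Y D_X Z - D_[X,Y] Z`. -/
def curvature (G : EuclideanSpace ℝ (Fin n) → Matrix (Fin n) (Fin n) ℝ)
    (l k i j : Fin n) (y : EuclideanSpace ℝ (Fin n)) : ℝ :=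
  partialDeriv i (christoffel G l j k) y - partialDeriv j (christoffel G l i k) y
    + ∑ m, (christoffel G l i m y * christoffel G m j k y
      - christoffel G l j m y * christoffel G m i k y)

/-- The component `Ric_jk = ∑ᵢ R^i_{kij}` of the Ricci tensor
`Ric(Y, Z) = tr (X ↦ R(X, Y) Z)`. -/
def ricciCoord (G : EuclideanSpace ℝ (Fin n) → Matrix (Fin n) (Fin n) ℝ)
    (j k : Fin n) (y : EuclideanSpace ℝ (Fin n)) : ℝ :=
  ∑ i, curvature G i k i j y

/-- The component `(Hess f)_ij = ∂_i ∂_j f - ∑ₖ Γᵏ_ij ∂_k f` of the Hessian. -/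
def hessCoord (G : EuclideanSpace ℝ (Fin n) → Matrix (Fin n) (Fin n) ℝ)
    (f : EuclideanSpace ℝ (Fin n) → ℝ) (i j : Fin n) (y : EuclideanSpace ℝ (Fin n)) : ℝ :=
  partialDeriv i (partialDeriv j f) y - ∑ k, christoffel G k i j y * partialDeriv k f y

end Coordinates

/-! ### A Riemannian manifold `(M, g)`

All tensors at `p` are computed in the preferred chart of `M` at `p`, the chart through which
Mathlib identifies `TangentSpace (𝓡 n) p` with `ℝⁿ`: the components of a tangent vector at `p` in
that chart are its entries. -/

section Manifold

variable {n : ℕ} {M : Type*} [TopologicalSpace M] [ChartedSpace (EuclideanSpace ℝ (Fin n)) M]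
  [IsManifold (𝓡 n) ∞ M]

/-- Smooth Riemannian metrics on `M`. -/
abbrev RiemMetric (n : ℕ) (M : Type*) [TopologicalSpace M]
    [ChartedSpace (EuclideanSpace ℝ (Fin n)) M] [IsManifold (𝓡 n) ∞ M] :=
  ContMDiffRiemannianMetric (𝓡 n) ∞ (EuclideanSpace ℝ (Fin n))
    (fun x : M => TangentSpace (𝓡 n) x)

/-- The components of the tangent vector `v` at `p` in the preferred chart at `p`. -/
def vecComp {p : M} (v : TangentSpace (𝓡 n) p) (i : Fin n) : ℝ :=
  (show EuclideanSpace ℝ (Fin n) from v) i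

/-- The components `g_ij = g(∂_i, ∂_j)` of the metric in the preferred chart at `p`, where
`∂_i` is the image of the `i`-th coordinate vector under the inverse of the chart. -/
def metricCoord (g : RiemMetric n M) (p : M) (y : EuclideanSpace ℝ (Fin n)) :
    Matrix (Fin n) (Fin n) ℝ :=
  Matrix.of fun i j =>
    g.inner ((chartAt (EuclideanSpace ℝ (Fin n)) p).symm y)
      (mfderiv (𝓡 n) (𝓡 n) (chartAt (EuclideanSpace ℝ (Fin n)) p).symm y (basisVec i))
      (mfderiv (𝓡 n) (𝓡 n) (chartAt (EuclideanSpace ℝ (Fin n)) p).symm y (basisVec j))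

/-- The Ricci tensor of `g` at `p`. -/
def ric (g : RiemMetric n M) (p : M) (v w : TangentSpace (𝓡 n) p) : ℝ :=
  ∑ i, ∑ j, vecComp v i * vecComp w j *
    ricciCoord (metricCoord g p) i j (chartAt (EuclideanSpace ℝ (Fin n)) p p)

/-- The function `u` in the preferred chart at `p`. -/
def inChart (u : M → ℝ) (p : M) : EuclideanSpace ℝ (Fin n) → ℝ :=
  u ∘ (chartAt (EuclideanSpace ℝ (Fin n)) p).symm

/-- The Hessian of `u` at `p`. -/
def hess (g : RiemMetric n M) (u : M → ℝ) (p : M) (v w : TangentSpace (𝓡 n) p) : ℝ :=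
  ∑ i, ∑ j, vecComp v i * vecComp w j *
    hessCoord (metricCoord g p) (inChart u p) i j (chartAt (EuclideanSpace ℝ (Fin n)) p p)

/-- The Laplacian `Δu = tr_g Hess u` at `p`. -/
def laplacian (g : RiemMetric n M) (u : M → ℝ) (p : M) : ℝ :=
  ∑ i, ∑ j, (metricCoord g p (chartAt (EuclideanSpace ℝ (Fin n)) p p))⁻¹ i j *
    hessCoord (metricCoord g p) (inChart u p) i j (chartAt (EuclideanSpace ℝ (Fin n)) p p)

/-- `L*u = -(Δu) g + Hess u - u Ric` at `p`. -/
def LStar (g : RiemMetric n M) (u : M → ℝ) (p : M) (v w : TangentSpace (𝓡 n) p) : ℝ :=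
  -(laplacian g u p) * g.inner p v w + hess g u p v w - u p * ric g p v w

/-- The components of the vector field `Y` in the preferred chart at `p`. -/
def fieldInChart (Y : (x : M) → TangentSpace (𝓡 n) x) (p : M) (y : EuclideanSpace ℝ (Fin n)) :
    EuclideanSpace ℝ (Fin n) :=
  mfderiv (𝓡 n) (𝓡 n) (chartAt (EuclideanSpace ℝ (Fin n)) p)
    ((chartAt (EuclideanSpace ℝ (Fin n)) p).symm y)
    (Y ((chartAt (EuclideanSpace ℝ (Fin n)) p).symm y))

/-- The covariant derivative `D_v Y` at `p` of the Levi-Civita connection, with components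
`(D_v Y)ᵏ = ∑ᵢ vⁱ ∂_i Yᵏ + ∑ᵢⱼ Γᵏ_ij vⁱ Yʲ`. -/
def covDeriv (g : RiemMetric n M) (p : M) (v : TangentSpace (𝓡 n) p)
    (Y : (x : M) → TangentSpace (𝓡 n) x) : TangentSpace (𝓡 n) p :=
  (WithLp.toLp 2 fun k =>
    (∑ i, vecComp v i * partialDeriv i (fun y => fieldInChart Y p y k)
        (chartAt (EuclideanSpace ℝ (Fin n)) p p))
      + ∑ i, ∑ j, christoffel (metricCoord g p) k i j (chartAt (EuclideanSpace ℝ (Fin n)) p p)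
          * vecComp v i * vecComp (Y p) j : EuclideanSpace ℝ (Fin n))

/-! ### Domains with smooth boundary -/

/-- `ρ` is a smooth defining function of `Ω` near the boundary point `p`: near `p`, the set `Ω` is
`{ρ < 0}`, and `ρ(p) = 0`, `dρ(p) ≠ 0`. -/
def IsDefiningFunction (n : ℕ) {M : Type*} [TopologicalSpace M]
    [ChartedSpace (EuclideanSpace ℝ (Fin n)) M] (Ω : Set M) (p : M) (ρ : M → ℝ) : Prop :=
  ContMDiff (𝓡 n) 𝓘(ℝ, ℝ) ∞ ρ ∧ ρ p = 0 ∧ mvfderiv (𝓡 n) ρ p ≠ 0 ∧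
    ∀ᶠ x in 𝓝 p, (x ∈ Ω ↔ ρ x < 0)

/-- A smooth domain: a connected (in particular nonempty) open set, near each point of its boundary
`Σ = frontier Ω` the side `{ρ < 0}` of a smooth hypersurface `{ρ = 0}`. -/
structure IsSmoothDomain (n : ℕ) {M : Type*} [TopologicalSpace M]
    [ChartedSpace (EuclideanSpace ℝ (Fin n)) M] (Ω : Set M) : Prop where
  isOpen : IsOpen Ω
  isConnected : IsConnected Ω
  smooth_boundary : ∀ p ∈ frontier Ω, ∃ ρ : M → ℝ, IsDefiningFunction n Ω p ρ

/-- The vector `v` at `p ∈ Σ` is tangent to `Σ`. -/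
def IsTangentToBoundary (Ω : Set M) (p : M) (v : TangentSpace (𝓡 n) p) : Prop :=
  ∀ ρ : M → ℝ, IsDefiningFunction n Ω p ρ → mvfderiv (𝓡 n) ρ p v = 0

/-- `ν` is the outward unit normal to `Σ` at `p`. -/
structure IsOutwardUnitNormal (g : RiemMetric n M) (Ω : Set M) (p : M)
    (ν : TangentSpace (𝓡 n) p) : Prop where
  unit : g.inner p ν ν = 1
  normal : ∀ v : TangentSpace (𝓡 n) p, IsTangentToBoundary Ω p v → g.inner p ν v = 0
  outward : ∀ ρ : M → ℝ, IsDefiningFunction n Ω p ρ → 0 < mvfderiv (𝓡 n) ρ p ν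

/-- `Y` is a smooth vector field defined near `p` that is tangent to `Σ` along `Σ`. -/
def IsTangentialFieldAt (Ω : Set M) (p : M) (Y : (x : M) → TangentSpace (𝓡 n) x) : Prop :=
  (∀ᶠ x in 𝓝 p, ContMDiffAt (𝓡 n) (𝓡 n).tangent ∞
    (fun z => (⟨z, Y z⟩ : TangentBundle (𝓡 n) M)) x) ∧
  ∀ᶠ x in 𝓝[frontier Ω] p, IsTangentToBoundary Ω x (Y x)

/-- `h(X, Y) = -⟨ν, D_X Y⟩` at `p`. -/
def secondFundamentalForm (g : RiemMetric n M) (p : M) (ν : TangentSpace (𝓡 n) p)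
    (X Y : (x : M) → TangentSpace (𝓡 n) x) : ℝ :=
  -(g.inner p ν (covDeriv g p (X p) Y))

/-- The boundary condition `u_ν ĝ = u h` on `Σ`, as an identity of symmetric bilinear forms,
tested on vector fields tangent to `Σ`. -/
def BoundaryCondition (g : RiemMetric n M) (Ω : Set M) (u : M → ℝ) : Prop :=
  ∀ p ∈ frontier Ω, ∀ ν : TangentSpace (𝓡 n) p, IsOutwardUnitNormal g Ω p ν →
    ∀ X Y : (x : M) → TangentSpace (𝓡 n) x,
      IsTangentialFieldAt Ω p X → IsTangentialFieldAt Ω p Y →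
        mvfderiv (𝓡 n) u p ν * g.inner p (X p) (Y p) =
          u p * secondFundamentalForm g p ν X Y

/-- `ker Φ*`, the space of static potentials (with `0`) on `(Ω, Σ)`: the functions `u` on the
closure of `Ω` that are smooth up to the boundary, i.e. restrictions of a smooth function `U`,
and that satisfy `L*u = 0` in `Ω` and `u_ν ĝ = u h` on `Σ`. As `Ω` is dense in its closure, the
first derivatives of `U` at points of the closure are determined by `u`. -/
def kerPhiStar (g : RiemMetric n M) (Ω : Set M) : Set (closure Ω → ℝ) :=
  {u | ∃ U : M → ℝ, ContMDiff (𝓡 n) 𝓘(ℝ, ℝ) ∞ U ∧ (∀ x : closure Ω, U x = u x) ∧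
    (∀ p ∈ Ω, ∀ v w : TangentSpace (𝓡 n) p, LStar g U p v w = 0) ∧
    BoundaryCondition g Ω U}

/-- `(Ω, Σ)` is a non-generic domain: a smooth domain with a static potential. Completeness of
the closure of `Ω` is automatic when `M` is complete, in particular on the compact sphere. -/
def IsNonGenericDomain (g : RiemMetric n M) (Ω : Set M) : Prop :=
  IsSmoothDomain n Ω ∧ ∃ u ∈ kerPhiStar g Ω, u ≠ 0

/-- A non-generic domain is simple if its boundary has exactly one connected component. -/
def IsSimpleNonGenericDomain (g : RiemMetric n M) (Ω : Set M) : Prop :=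
  IsNonGenericDomain g Ω ∧ IsConnected (frontier Ω)

end Manifold

/-! ### The round sphere -/

section Sphere

/-- The unit sphere `𝕊ⁿ` of `ℝⁿ⁺¹`. -/
abbrev UnitSphere (n : ℕ) : Type := Metric.sphere (0 : EuclideanSpace ℝ (Fin (n + 1))) 1

/-- The differential of the inclusion `𝕊ⁿ → ℝⁿ⁺¹` at `x`. -/
def inclDeriv (n : ℕ) (x : UnitSphere n) :
    TangentSpace (𝓡 n) x →L[ℝ] EuclideanSpace ℝ (Fin (n + 1)) :=
  mvfderiv (𝓡 n) (Subtype.val : UnitSphere n → EuclideanSpace ℝ (Fin (n + 1))) x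

/-- The same map, with the tangent space written as `ℝⁿ`. -/
def inclDeriv' (n : ℕ) (x : UnitSphere n) :
    EuclideanSpace ℝ (Fin n) →L[ℝ] EuclideanSpace ℝ (Fin (n + 1)) := inclDeriv n x

theorem inclDeriv_injective (n : ℕ) (x : UnitSphere n) : Function.Injective (inclDeriv' n x) := by
  have := Fact.mk (@finrank_euclideanSpace_fin ℝ _ (n + 1))
  exact injective_mvfderiv_subtypeVal_sphere (n := n) x

/-- The pullback of the Euclidean inner product under a linear map. -/
def pullbackInner {n m : ℕ} (A : EuclideanSpace ℝ (Fin n) →L[ℝ] EuclideanSpace ℝ (Fin m)) :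
    EuclideanSpace ℝ (Fin n) →L[ℝ] EuclideanSpace ℝ (Fin n) →L[ℝ] ℝ :=
  (innerSL ℝ : EuclideanSpace ℝ (Fin m) →L[ℝ] EuclideanSpace ℝ (Fin m) →L[ℝ] ℝ).bilinearComp A A

/-- The metric induced on `𝕊ⁿ` by the Euclidean metric of `ℝⁿ⁺¹`. -/
def roundInner (n : ℕ) (x : UnitSphere n) :
    TangentSpace (𝓡 n) x →L[ℝ] TangentSpace (𝓡 n) x →L[ℝ] ℝ :=
  letI A : EuclideanSpace ℝ (Fin n) →L[ℝ] EuclideanSpace ℝ (Fin (n + 1)) := inclDeriv n x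
  (innerSL ℝ : EuclideanSpace ℝ (Fin (n + 1)) →L[ℝ] EuclideanSpace ℝ (Fin (n + 1)) →L[ℝ] ℝ).bilinearComp A A

theorem roundInner_apply (n : ℕ) (x : UnitSphere n) (v w : TangentSpace (𝓡 n) x) :
    roundInner n x v w = inner ℝ (inclDeriv n x v) (inclDeriv n x w) := rfl

theorem roundInner_isVonNBounded (n : ℕ) (x : UnitSphere n) :
    Bornology.IsVonNBounded ℝ {v : TangentSpace (𝓡 n) x | roundInner n x v v < 1} := by
  obtain ⟨K, -, hK⟩ := LinearMap.exists_antilipschitzWith (inclDeriv' n x).toLinearMap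
    (LinearMap.ker_eq_bot.2 (inclDeriv_injective n x))
  change Bornology.IsVonNBounded ℝ {v : EuclideanSpace ℝ (Fin n) |
    inner ℝ (inclDeriv' n x v) (inclDeriv' n x v) < 1}
  refine (NormedSpace.isVonNBounded_ball ℝ _ ((K : ℝ) + 1)).subset ?_
  intro v hv
  have h1 := hK.le_mul_dist v 0
  simp only [Set.mem_ofPred_eq, real_inner_self_eq_norm_sq] at hv
  have h2 : ‖inclDeriv' n x v‖ < 1 := by nlinarith [norm_nonneg (inclDeriv' n x v)]
  have h5 : ‖v‖ ≤ K * ‖inclDeriv' n x v‖ := by simpa using h1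
  have h4 : (0:ℝ) ≤ K := K.2
  rw [mem_ball_zero_iff]
  nlinarith [norm_nonneg (inclDeriv' n x v)]

theorem inclDeriv_smooth (n : ℕ) (x : UnitSphere n) :
    ContMDiffAt (𝓡 n) 𝓘(ℝ, EuclideanSpace ℝ (Fin n) →L[ℝ] EuclideanSpace ℝ (Fin (n + 1))) ∞
      (fun y => (inclDeriv n y).comp
        ((trivializationAt (EuclideanSpace ℝ (Fin n)) (TangentSpace (𝓡 n)) x).symmL ℝ y)) x := by
  have := Fact.mk (@finrank_euclideanSpace_fin ℝ _ (n + 1))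
  have h := ContMDiffAt.mfderiv_const (m := ∞) (n := ∞) (I := 𝓡 n)
    (I' := 𝓘(ℝ, EuclideanSpace ℝ (Fin (n + 1))))
    (contMDiff_coe_sphere (E := EuclideanSpace ℝ (Fin (n + 1))) (n := n) (m := ∞) x) (by simp)
  convert! h using 1
  ext y v
  simp [inTangentCoordinates, ContinuousLinearMap.inCoordinates, inclDeriv, mvfderiv]
  rfl

theorem pullbackInner_contDiff (n m : ℕ) : ContDiff ℝ ∞
    (fun A : EuclideanSpace ℝ (Fin n) →L[ℝ] EuclideanSpace ℝ (Fin m) =>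
      (pullbackInner A : EuclideanSpace ℝ (Fin n) →L[ℝ] EuclideanSpace ℝ (Fin n) →L[ℝ] ℝ)) := by
  rw [contDiff_clm_apply_iff]
  intro v
  rw [contDiff_clm_apply_iff]
  intro w
  change ContDiff ℝ ∞ fun A : EuclideanSpace ℝ (Fin n) →L[ℝ] EuclideanSpace ℝ (Fin m) =>
    (inner ℝ (A v) (A w) : ℝ)
  exact (contDiff_id.clm_apply contDiff_const).inner ℝ (contDiff_id.clm_apply contDiff_const)

/-- The standard metric of `𝕊ⁿ`. -/
def roundMetric (n : ℕ) :
    ContMDiffRiemannianMetric (𝓡 n) ∞ (EuclideanSpace ℝ (Fin n))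
      (fun x : UnitSphere n => TangentSpace (𝓡 n) x) where
  inner := roundInner n
  symm x v w := by simp only [roundInner_apply, real_inner_comm]
  pos x v hv := by
    rw [roundInner_apply]
    refine real_inner_self_pos.2 fun h => hv ?_
    exact inclDeriv_injective n x (h.trans (map_zero (inclDeriv' n x)).symm)
  isVonNBounded := roundInner_isVonNBounded n
  contMDiff := by
    intro x
    rw [contMDiffAt_section]
    have h := inclDeriv_smooth n x
    have h2 := (pullbackInner_contDiff n (n + 1)).contMDiff.contMDiffAt.comp x h
    refine h2.congr_of_eventuallyEq ?_
    filter_upwards [(trivializationAt (EuclideanSpace ℝ (Fin n))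
      (TangentSpace (𝓡 n) : UnitSphere n → Type _) x).open_baseSet.mem_nhds
      (FiberBundle.mem_baseSet_trivializationAt' x)] with y hy
    ext v w
    change ContinuousLinearMap.inCoordinates (EuclideanSpace ℝ (Fin n)) (TangentSpace (𝓡 n))
      (EuclideanSpace ℝ (Fin n) →L[ℝ] ℝ) (fun x : UnitSphere n => TangentSpace (𝓡 n) x →L[ℝ] ℝ) x y x y
      (roundInner n y) v w = _
    rw [inCoordinates_apply_eq₂ (F₃ := ℝ) (E₃ := fun _ : UnitSphere n => ℝ)
      hy hy (Set.mem_univ _)]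
    change (_ : ℝ) = inner ℝ (inclDeriv n y (Trivialization.symmL ℝ _ y v))
      (inclDeriv n y (Trivialization.symmL ℝ _ y w))
    rw [Trivialization.symmL_apply _ hy, Trivialization.symmL_apply _ hy]
    simp [roundInner_apply]

/-- The north pole `(0, …, 0, 1)`. -/
def northPole (n : ℕ) : UnitSphere n :=
  ⟨EuclideanSpace.single (Fin.last n) 1, by simp⟩

/-- The open spherical cap of angular radius `θ` centered at `N`. -/
def sphericalCap {n : ℕ} (N : UnitSphere n) (θ : ℝ) : Set (UnitSphere n) :=
  {x | InnerProductGeometry.angle (N : EuclideanSpace ℝ (Fin (n + 1)))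
    (x : EuclideanSpace ℝ (Fin (n + 1))) < θ}

/-- `Ω` is a spherical cap: a cap of some center and of some angular radius in `(0, π)`. -/
def IsSphericalCap {n : ℕ} (Ω : Set (UnitSphere n)) : Prop :=
  ∃ (N : UnitSphere n) (θ : ℝ), 0 < θ ∧ θ < Real.pi ∧ Ω = sphericalCap N θ

/-- The coordinate `xᵢ` of `ℝⁿ⁺¹`, restricted to a subset of the sphere. -/
def coordFun {n : ℕ} (S : Set (UnitSphere n)) (i : Fin (n + 1)) : S → ℝ :=
  fun x => (x : UnitSphere n).1 i

end Sphere

end StaticDomain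

end

noncomputable section

namespace StaticDomain

variable {n : ℕ}

/-! ### The stereographic chart centred at a point of the sphere -/

/-! Extend `U` to `ℝⁿ⁺¹ ∖ 0` as the function `F = homExt U`, homogeneous of degree one. On vectors
tangent to the sphere, `D²F = Hess U + U g`, and since `Ric = (n - 1) g` the operator becomes `L*U =
D²F - tr(D²F) g` (`LStar_roundMetric`). For `n ≥ 2` the trace of `L*U = 0` forces `tr(D²F) = 0`, and
homogeneity kills the radial direction, so `L*U = 0` at a point iff `D²F = 0` there
(`forall_LStar_eq_zero_iff`). On a connected domain the solutions are therefore the linear functions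
`⟨a, x⟩`.

The boundary is treated the same way. If `ρ` is a defining function and `R = homExt ρ`, the normal
is a positive multiple of `∇R`, and `h` is the same multiple of `D²R` (`secondFundamentalForm_eq`).
The condition reads `⟨a, ∇R⟩⟨v, w⟩ = ⟨a, p⟩ D²R(v, w)` for `v, w` tangent to `Σ`
(`boundaryCondition_at_iff`). For a cap take `ρ = c - ⟨N, x⟩`: then `D²R = c g` on tangent vectors
and `∇R = c p - N` on the boundary, so the condition is exactly `⟨a, N⟩ = 0`. This settles the
statements about caps.

Conversely, along `Σ` the condition becomes `⟨a, x⟩ dν = ⟨a, ν⟩ dx` (`smul_fderiv_unitGradient`).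
Pairing with `a` shows that `l = ⟨a, ν⟩ / ⟨a, x⟩` has zero derivative, and then so does `ν - l x`.
At a boundary point where `⟨a, x⟩ = 0` the vector `a` is itself tangent to `Σ`, so the zeros of `⟨a,
x⟩` are nowhere dense nearby and `l` extends across them (`eventually_eq_smul_sub`). Hence `ν = c x
- b` locally, and on all of `Σ` when `Σ` is connected (`exists_outwardNormal_eq`). From `⟨ν, x⟩ = 0`
and `‖ν‖ = 1` follow `⟨b, x⟩ = c` and `‖b‖² = 1 + c²`: the boundary lies in a small sphere. The
complement of a small sphere is two open caps, and `Ω` has to be one of them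
(`isSphericalCap_of_frontier_subset`). -/

abbrev Euc (m : ℕ) : Type := EuclideanSpace ℝ (Fin m)

/-- A linear isometry of `ℝⁿ` onto the orthogonal complement of `p`. -/
def tangentFrame (p : UnitSphere n) : Euc n →ₗᵢ[ℝ] Euc (n + 1) :=
  haveI := Fact.mk (@finrank_euclideanSpace_fin ℝ _ (n + 1))
  (Submodule.subtypeₗᵢ (Submodule.span ℝ {((-p : UnitSphere n) : Euc (n + 1))})ᗮ).comp
    (OrthonormalBasis.fromOrthogonalSpanSingleton (𝕜 := ℝ) n
      (ne_zero_of_mem_unit_sphere (-p))).repr.symm.toLinearIsometry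

/-- The conformal factor `(‖y‖² + 4)⁻¹`, up to a constant. -/
def stereoFactor (y : Euc n) : ℝ := (‖y‖ ^ 2 + 4)⁻¹

/-- The inverse of the stereographic projection centred at `p`, as a map into `ℝⁿ⁺¹`. -/
def stereoMap (p : UnitSphere n) (y : Euc n) : Euc (n + 1) :=
  stereoFactor y • ((4 : ℝ) • tangentFrame p y + (8 : ℝ) • (p : Euc (n + 1))) - (p : Euc (n + 1))

theorem stereoFactor_pos (y : Euc n) : 0 < stereoFactor y := by
  unfold stereoFactor; positivity

theorem stereoFactor_zero : stereoFactor (0 : Euc n) = 1 / 4 := by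
  simp [stereoFactor]

theorem stereoFactor_mul (y : Euc n) : stereoFactor y * (‖y‖ ^ 2 + 4) = 1 := by
  unfold stereoFactor
  exact inv_mul_cancel₀ (by positivity)

theorem norm_unitSphere (p : UnitSphere n) : ‖(p : Euc (n + 1))‖ = 1 := norm_eq_of_mem_sphere p

theorem inner_self_unitSphere (p : UnitSphere n) :
    inner ℝ (p : Euc (n + 1)) (p : Euc (n + 1)) = (1 : ℝ) := by
  rw [real_inner_self_eq_norm_sq, norm_unitSphere]; norm_num

theorem unitSphere_ne_zero (p : UnitSphere n) : (p : Euc (n + 1)) ≠ 0 :=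
  ne_zero_of_mem_unit_sphere p

theorem inner_frame (p : UnitSphere n) (v w : Euc n) :
    inner ℝ (tangentFrame p v) (tangentFrame p w) = (inner ℝ v w : ℝ) :=
  (tangentFrame p).inner_map_map v w

theorem inner_point_frame (p : UnitSphere n) (v : Euc n) :
    inner ℝ (p : Euc (n + 1)) (tangentFrame p v) = (0 : ℝ) := by
  have := Fact.mk (@finrank_euclideanSpace_fin ℝ _ (n + 1))
  have h := (Submodule.mem_orthogonal_singleton_iff_inner_right (𝕜 := ℝ)
    (u := ((-p : UnitSphere n) : Euc (n + 1))) (v := tangentFrame p v)).1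
    (Subtype.property _)
  simpa using h

theorem inner_frame_point (p : UnitSphere n) (v : Euc n) :
    inner ℝ (tangentFrame p v) (p : Euc (n + 1)) = (0 : ℝ) := by
  rw [real_inner_comm, inner_point_frame]

theorem exists_frame_eq (p : UnitSphere n) {w : Euc (n + 1)}
    (hw : inner ℝ (p : Euc (n + 1)) w = (0 : ℝ)) : ∃ v : Euc n, tangentFrame p v = w := by
  have := Fact.mk (@finrank_euclideanSpace_fin ℝ _ (n + 1))
  have h : w ∈ (Submodule.span ℝ {((-p : UnitSphere n) : Euc (n + 1))})ᗮ := by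
    rw [Submodule.mem_orthogonal_singleton_iff_inner_right]
    simpa using hw
  refine ⟨(OrthonormalBasis.fromOrthogonalSpanSingleton (𝕜 := ℝ) n
      (ne_zero_of_mem_unit_sphere (-p))).repr ⟨w, h⟩, ?_⟩
  exact congrArg Subtype.val (LinearIsometryEquiv.symm_apply_apply
    (OrthonormalBasis.fromOrthogonalSpanSingleton (𝕜 := ℝ) n
      (ne_zero_of_mem_unit_sphere (-p))).repr ⟨w, h⟩)

theorem exists_eq_smul_add_frame (p : UnitSphere n) (v : Euc (n + 1)) : ∃ x : Euc n,
    v = (inner ℝ (p : Euc (n + 1)) v : ℝ) • (p : Euc (n + 1)) + tangentFrame p x := by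
  obtain ⟨x, hx⟩ := exists_frame_eq p
    (w := v - (inner ℝ (p : Euc (n + 1)) v : ℝ) • (p : Euc (n + 1))) (by
      rw [inner_sub_right, inner_smul_right, inner_self_unitSphere]; ring)
  exact ⟨x, by rw [hx]; abel⟩

theorem chart_target (p : UnitSphere n) : (chartAt (Euc n) p).target = Set.univ := by
  have := Fact.mk (@finrank_euclideanSpace_fin ℝ _ (n + 1))
  exact stereographic'_target _

theorem chart_source (p : UnitSphere n) : (chartAt (Euc n) p).source = {-p}ᶜ := by
  have := Fact.mk (@finrank_euclideanSpace_fin ℝ _ (n + 1))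
  exact stereographic'_source _

/-- The preferred chart at `p` is stereographic projection from the antipode `-p`. Writing `(‖y‖² -
4) / (‖y‖² + 4)` as `1 - 8 * stereoFactor y` gives the form of `stereoMap`, which has a single
nonconstant scalar factor to differentiate. -/
theorem coe_chart_symm (p : UnitSphere n) (y : Euc n) :
    (((chartAt (Euc n) p).symm y : UnitSphere n) : Euc (n + 1)) = stereoMap p y := by
  have := Fact.mk (@finrank_euclideanSpace_fin ℝ _ (n + 1))
  have h := stereographic'_symm_apply (-p) y
  refine h.trans ?_
  have h2 : ((OrthonormalBasis.fromOrthogonalSpanSingleton (𝕜 := ℝ) n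
      (ne_zero_of_mem_unit_sphere (-p))).repr.symm y : Euc (n + 1)) = tangentFrame p y := rfl
  simp only [h2, LinearIsometry.norm_map]
  have h3 : (((-p : UnitSphere n)) : Euc (n + 1)) = -(p : Euc (n + 1)) := rfl
  have h4 := stereoFactor_mul y
  rw [h3, stereoMap]
  change stereoFactor y • _ + stereoFactor y • _ = _
  match_scalars
  · ring
  · linear_combination (-1 : ℝ) * h4

theorem stereoMap_zero (p : UnitSphere n) : stereoMap p 0 = p := by
  rw [stereoMap, stereoFactor_zero, map_zero]
  match_scalars
  norm_num

theorem chart_symm_zero (p : UnitSphere n) : (chartAt (Euc n) p).symm 0 = p :=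
  Subtype.ext ((coe_chart_symm p 0).trans (stereoMap_zero p))

theorem chart_self (p : UnitSphere n) : chartAt (Euc n) p p = 0 := by
  have h := (chartAt (Euc n) p).right_inv (x := 0) (by rw [chart_target]; trivial)
  rwa [chart_symm_zero] at h

theorem norm_stereoMap (p : UnitSphere n) (y : Euc n) : ‖stereoMap p y‖ = 1 := by
  rw [← coe_chart_symm]; exact norm_unitSphere _

theorem stereoMap_ne_zero (p : UnitSphere n) (y : Euc n) : stereoMap p y ≠ 0 := by
  rw [← norm_ne_zero_iff, norm_stereoMap]; norm_num

theorem contDiff_stereoFactor : ContDiff ℝ ω (stereoFactor : Euc n → ℝ) := by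
  refine ContDiff.inv ((contDiff_norm_sq ℝ).add contDiff_const) fun y => ?_
  positivity

theorem contDiff_stereoMap (p : UnitSphere n) : ContDiff ℝ ω (stereoMap p) := by
  refine ContDiff.sub (contDiff_stereoFactor.smul (ContDiff.add ?_ contDiff_const)) contDiff_const
  exact (tangentFrame p).contDiff.const_smul (4 : ℝ)

theorem hasFDerivAt_stereoFactor (y : Euc n) :
    HasFDerivAt stereoFactor ((-(2 * stereoFactor y ^ 2)) • innerSL ℝ y) y := by
  have h : HasFDerivAt (fun w : Euc n => ‖w‖ ^ 2 + 4) (2 • innerSL ℝ y) y :=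
    (hasStrictFDerivAt_norm_sq y).hasFDerivAt.add_const 4
  have h2 := (hasDerivAt_inv (show ‖y‖ ^ 2 + 4 ≠ 0 by positivity)).comp_hasFDerivAt y h
  refine h2.congr_fderiv ?_
  ext v
  simp only [smul_apply, stereoFactor, smul_eq_mul, nsmul_eq_mul]
  field_simp
  push_cast
  ring

theorem hasFDerivAt_stereoMap (p : UnitSphere n) (y : Euc n) :
    HasFDerivAt (stereoMap p)
      ((stereoFactor y * 4) • (tangentFrame p).toContinuousLinearMap +
        ((-(2 * stereoFactor y ^ 2)) • innerSL ℝ y).smulRight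
          ((4 : ℝ) • tangentFrame p y + (8 : ℝ) • (p : Euc (n + 1)))) y := by
  have h : HasFDerivAt (fun y => (4 : ℝ) • tangentFrame p y + (8 : ℝ) • (p : Euc (n + 1)))
      ((4 : ℝ) • (tangentFrame p).toContinuousLinearMap) y :=
    (((tangentFrame p).toContinuousLinearMap.hasFDerivAt (x := y)).const_smul (4 : ℝ)).add_const _
  have h2 := ((hasFDerivAt_stereoFactor y).smul h).sub_const (p : Euc (n + 1))
  refine h2.congr_fderiv ?_
  rw [mul_smul]

theorem fderiv_stereoMap_apply (p : UnitSphere n) (y v : Euc n) :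
    fderiv ℝ (stereoMap p) y v = (stereoFactor y * 4) • tangentFrame p v +
      (-(2 * stereoFactor y ^ 2) * inner ℝ y v) •
        ((4 : ℝ) • tangentFrame p y + (8 : ℝ) • (p : Euc (n + 1))) := by
  rw [(hasFDerivAt_stereoMap p y).fderiv]
  simp

theorem fderiv_stereoMap_zero (p : UnitSphere n) (v : Euc n) :
    fderiv ℝ (stereoMap p) 0 v = tangentFrame p v := by
  rw [fderiv_stereoMap_apply, stereoFactor_zero]
  simp

/-- Conformality of the chart: the terms in `⟨y, v⟩⟨y, w⟩` cancel because `stereoFactor y * (‖y‖² +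
4) = 1`. -/
theorem inner_fderiv_stereoMap (p : UnitSphere n) (y v w : Euc n) :
    inner ℝ (fderiv ℝ (stereoMap p) y v) (fderiv ℝ (stereoMap p) y w) =
      16 * stereoFactor y ^ 2 * inner ℝ v w := by
  have h := stereoFactor_mul y
  simp only [fderiv_stereoMap_apply, inner_add_left, inner_add_right, inner_smul_left,
    inner_smul_right, inner_frame, inner_point_frame, inner_frame_point, inner_self_unitSphere,
    conj_trivial, real_inner_self_eq_norm_sq y, real_inner_comm y v]
  linear_combination (64 * stereoFactor y ^ 3 * inner ℝ y v * inner ℝ y w) * h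

/-! ### The round metric in the chart -/

theorem contMDiff_chart_symm (p : UnitSphere n) :
    ContMDiff 𝓘(ℝ, Euc n) (𝓡 n) ω (chartAt (Euc n) p).symm := by
  have h := contMDiffOn_chart_symm (I := 𝓡 n) (n := ω) (x := p) (H := Euc n)
  rw [chart_target] at h
  exact contMDiffOn_univ.1 h

theorem contMDiff_coe : ContMDiff (𝓡 n) 𝓘(ℝ, Euc (n + 1)) ω
    (Subtype.val : UnitSphere n → Euc (n + 1)) := by
  have := Fact.mk (@finrank_euclideanSpace_fin ℝ _ (n + 1))
  exact contMDiff_coe_sphere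

theorem mvfderiv_comp_chart_symm {F : Type*} [NormedAddCommGroup F] [NormedSpace ℝ F]
    (p : UnitSphere n) {ρ : UnitSphere n → F} (y : Euc n)
    (hρ : MDifferentiableAt (𝓡 n) 𝓘(ℝ, F) ρ ((chartAt (Euc n) p).symm y)) (v : Euc n) :
    mvfderiv (𝓡 n) ρ ((chartAt (Euc n) p).symm y)
      (mfderiv (𝓡 n) (𝓡 n) (chartAt (Euc n) p).symm y v) =
      fderiv ℝ (ρ ∘ (chartAt (Euc n) p).symm) y v := by
  have h := mfderiv_comp_apply (I := 𝓘(ℝ, Euc n)) (I' := 𝓡 n) (I'' := 𝓘(ℝ, F)) y hρ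
    ((contMDiff_chart_symm p).mdifferentiable (by simp) y) v
  rw [mfderiv_eq_fderiv] at h
  exact h.symm

theorem coe_comp_chart_symm (p : UnitSphere n) :
    (Subtype.val : UnitSphere n → Euc (n + 1)) ∘ (chartAt (Euc n) p).symm = stereoMap p :=
  funext fun y => coe_chart_symm p y

theorem inclDeriv_chart_symm (p : UnitSphere n) (y v : Euc n) :
    inclDeriv n ((chartAt (Euc n) p).symm y)
      (mfderiv (𝓡 n) (𝓡 n) (chartAt (Euc n) p).symm y v) = fderiv ℝ (stereoMap p) y v := by
  rw [inclDeriv, mvfderiv_comp_chart_symm p y (contMDiff_coe.mdifferentiable (by simp) _),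
    coe_comp_chart_symm]

/-- The preferred chart at `p` identifies the tangent space at `p` with `ℝⁿ` through the identity. -/
theorem mvfderiv_eq_fderiv_chart {F : Type*} [NormedAddCommGroup F] [NormedSpace ℝ F]
    (p : UnitSphere n) {ρ : UnitSphere n → F} (hρ : MDifferentiableAt (𝓡 n) 𝓘(ℝ, F) ρ p)
    (v : TangentSpace (𝓡 n) p) :
    mvfderiv (𝓡 n) ρ p v = fderiv ℝ (ρ ∘ (chartAt (Euc n) p).symm) 0 (show Euc n from v) := by
  rw [hρ.mvfderiv]
  simp only [mfld_simps, fderivWithin_univ, chart_self]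
  rfl

theorem inclDeriv_eq (p : UnitSphere n) (v : TangentSpace (𝓡 n) p) :
    inclDeriv n p v = tangentFrame p (show Euc n from v) := by
  rw [inclDeriv, mvfderiv_eq_fderiv_chart p (contMDiff_coe.mdifferentiable (by simp) _),
    coe_comp_chart_symm, fderiv_stereoMap_zero]

theorem roundMetric_inner (p : UnitSphere n) (v w : TangentSpace (𝓡 n) p) :
    (roundMetric n).inner p v w = inner ℝ (show Euc n from v) (show Euc n from w) := by
  change roundInner n p v w = _
  rw [roundInner_apply, inclDeriv_eq, inclDeriv_eq, inner_frame]

theorem metricCoord_roundMetric (p : UnitSphere n) (y : Euc n) :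
    metricCoord (roundMetric n) p y = (16 * stereoFactor y ^ 2) • (1 : Matrix (Fin n) (Fin n) ℝ) := by
  ext i j
  change roundInner n ((chartAt (Euc n) p).symm y) _ _ = _
  rw [roundInner_apply, inclDeriv_chart_symm, inclDeriv_chart_symm, inner_fderiv_stereoMap]
  simp [Matrix.one_apply, EuclideanSpace.inner_single_left]

theorem metricCoord_roundMetric_apply (p : UnitSphere n) (y : Euc n) (i j : Fin n) :
    metricCoord (roundMetric n) p y i j = if i = j then 16 * stereoFactor y ^ 2 else 0 := by
  rw [metricCoord_roundMetric]
  simp [Matrix.one_apply]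

theorem metricCoord_roundMetric_zero (p : UnitSphere n) :
    metricCoord (roundMetric n) p 0 = 1 := by
  rw [metricCoord_roundMetric, stereoFactor_zero]
  norm_num

theorem inv_metricCoord_roundMetric (p : UnitSphere n) (y : Euc n) (i j : Fin n) :
    (metricCoord (roundMetric n) p y)⁻¹ i j =
      if i = j then (16 * stereoFactor y ^ 2)⁻¹ else 0 := by
  have h : (16 * stereoFactor y ^ 2) ≠ 0 := by have := stereoFactor_pos y; positivity
  have h2 : (metricCoord (roundMetric n) p y)⁻¹ =
      (16 * stereoFactor y ^ 2)⁻¹ • (1 : Matrix (Fin n) (Fin n) ℝ) := by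
    refine Matrix.inv_eq_right_inv ?_
    rw [metricCoord_roundMetric, Matrix.smul_mul, one_mul, smul_smul, mul_inv_cancel₀ h, one_smul]
  rw [h2]
  simp [Matrix.one_apply]

theorem partialDeriv_metricCoord (p : UnitSphere n) (y : Euc n) (k i j : Fin n) :
    partialDeriv k (fun z => metricCoord (roundMetric n) p z i j) y =
      if i = j then -(64 * stereoFactor y ^ 3 * y k) else 0 := by
  simp only [metricCoord_roundMetric_apply, partialDeriv]
  split_ifs with h
  · rw [(((hasFDerivAt_stereoFactor y).pow 2).const_mul 16).fderiv]
    simp [EuclideanSpace.inner_single_right]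
    ring
  · simp

theorem christoffel_roundMetric (p : UnitSphere n) (y : Euc n) (k i j : Fin n) :
    christoffel (metricCoord (roundMetric n) p) k i j y =
      -(2 * stereoFactor y) * ((if j = k then y i else 0) + (if i = k then y j else 0) -
        (if i = j then y k else 0)) := by
  have h : stereoFactor y ≠ 0 := (stereoFactor_pos y).ne'
  simp only [christoffel, partialDeriv_metricCoord, inv_metricCoord_roundMetric, ite_mul, zero_mul,
    Finset.sum_ite_eq, Finset.mem_univ, if_true]
  split_ifs <;> field_simp <;> ring

/-- The conformal factor is critical at the origin, so at `p` Hessians and covariant derivatives are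
ordinary derivatives in the chart, and only derivatives of Christoffel symbols enter the curvature.
-/
theorem christoffel_roundMetric_zero (p : UnitSphere n) (k i j : Fin n) :
    christoffel (metricCoord (roundMetric n) p) k i j 0 = 0 := by
  rw [christoffel_roundMetric]
  simp

theorem partialDeriv_christoffel_zero (p : UnitSphere n) (l k i j : Fin n) :
    partialDeriv l (christoffel (metricCoord (roundMetric n) p) k i j) 0 =
      -(1 / 2) * ((if j = k then (if i = l then 1 else 0) else 0) +
        (if i = k then (if j = l then 1 else 0) else 0) -
        (if i = j then (if k = l then 1 else 0) else 0)) := by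
  have hc : ∀ m : Fin n, HasFDerivAt (fun y : Euc n => y m)
      (EuclideanSpace.proj m : Euc n →L[ℝ] ℝ) 0 := fun m =>
    (EuclideanSpace.proj m : Euc n →L[ℝ] ℝ).hasFDerivAt
  have hite : ∀ (q : Prop) [Decidable q] (m : Fin n),
      HasFDerivAt (fun y : Euc n => if q then y m else 0)
        (if q then (EuclideanSpace.proj m : Euc n →L[ℝ] ℝ) else 0) 0 := by
    intro q _ m
    split_ifs
    · exact hc m
    · exact hasFDerivAt_const _ _
  have h := ((hasFDerivAt_stereoFactor (0 : Euc n)).const_mul 2).neg.mul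
    (((hite (j = k) i).add (hite (i = k) j)).sub (hite (i = j) k))
  have h2 : christoffel (metricCoord (roundMetric n) p) k i j = fun y : Euc n =>
      -(2 * stereoFactor y) * ((if j = k then y i else 0) + (if i = k then y j else 0) -
        (if i = j then y k else 0)) := funext fun y => christoffel_roundMetric p y k i j
  rw [partialDeriv, h2]
  erw [h.fderiv]
  have e : ∀ (q : Prop) [Decidable q] (m : Fin n),
      (if q then (EuclideanSpace.proj m : Euc n →L[ℝ] ℝ) else 0) (basisVec l) =
        if q then (if m = l then 1 else 0) else 0 := by
    intro q _ m
    split_ifs <;> simp_all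
  simp [e, stereoFactor_zero]
  ring_nf
  simp

theorem ricciCoord_roundMetric (p : UnitSphere n) (j k : Fin n) :
    ricciCoord (metricCoord (roundMetric n) p) j k 0 = if j = k then (n : ℝ) - 1 else 0 := by
  have h : ∀ i : Fin n, curvature (metricCoord (roundMetric n) p) i k i j 0 =
      (if j = k then 1 else 0) - (if i = j then (if i = k then 1 else 0) else 0) := by
    intro i
    simp only [curvature, christoffel_roundMetric_zero, partialDeriv_christoffel_zero, mul_zero,
      sub_zero, Finset.sum_const_zero, add_zero]
    by_cases h1 : i = j <;> by_cases h2 : i = k <;> by_cases h3 : j = k <;>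
      simp_all [eq_comm] <;> norm_num
  simp only [ricciCoord, h, Finset.sum_sub_distrib, Finset.sum_const, Finset.card_univ,
    Fintype.card_fin, Finset.sum_ite_eq', Finset.mem_univ, if_true]
  split_ifs <;> simp

theorem hessCoord_roundMetric (p : UnitSphere n) (f : Euc n → ℝ) (i j : Fin n) :
    hessCoord (metricCoord (roundMetric n) p) f i j 0 = partialDeriv i (partialDeriv j f) 0 := by
  simp [hessCoord, christoffel_roundMetric_zero]

/-! ### The homogeneous extension of degree one -/

theorem normalize_mem {z : Euc (n + 1)} (hz : z ≠ 0) :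
    ‖z‖⁻¹ • z ∈ Metric.sphere (0 : Euc (n + 1)) 1 := by
  rw [mem_sphere_zero_iff_norm, norm_smul, norm_inv, norm_norm,
    inv_mul_cancel₀ (norm_ne_zero_iff.2 hz)]

open Classical in
/-- The extension of a function on the sphere to `ℝⁿ⁺¹` that is homogeneous of degree one. -/
def homExt (U : UnitSphere n → ℝ) (z : Euc (n + 1)) : ℝ :=
  if h : z ≠ 0 then ‖z‖ * U ⟨‖z‖⁻¹ • z, normalize_mem h⟩ else 0

theorem homExt_smul_coe (U : UnitSphere n → ℝ) {t : ℝ} (ht : 0 < t) (p : UnitSphere n) :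
    homExt U (t • (p : Euc (n + 1))) = t * U p := by
  have h : t • (p : Euc (n + 1)) ≠ 0 := smul_ne_zero ht.ne' (unitSphere_ne_zero p)
  have h1 : ‖t • (p : Euc (n + 1))‖ = t := by
    rw [norm_smul, norm_unitSphere, mul_one, Real.norm_of_nonneg ht.le]
  rw [homExt, dif_pos h]
  congr 2
  apply Subtype.ext
  change ‖t • (p : Euc (n + 1))‖⁻¹ • t • (p : Euc (n + 1)) = p
  rw [h1, smul_smul, inv_mul_cancel₀ ht.ne', one_smul]

theorem homExt_coe (U : UnitSphere n → ℝ) (p : UnitSphere n) : homExt U p = U p := by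
  simpa using homExt_smul_coe U one_pos p

theorem exists_eq_smul_coe {z : Euc (n + 1)} (hz : z ≠ 0) :
    ∃ t : ℝ, 0 < t ∧ ∃ p : UnitSphere n, z = t • (p : Euc (n + 1)) := by
  refine ⟨‖z‖, norm_pos_iff.2 hz, ⟨‖z‖⁻¹ • z, normalize_mem hz⟩, ?_⟩
  change z = ‖z‖ • ‖z‖⁻¹ • z
  rw [smul_smul, mul_inv_cancel₀ (norm_ne_zero_iff.2 hz), one_smul]

theorem homExt_smul (U : UnitSphere n → ℝ) {t : ℝ} (ht : 0 < t) (z : Euc (n + 1)) :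
    homExt U (t • z) = t * homExt U z := by
  by_cases hz : z = 0
  · simp [hz, homExt]
  · obtain ⟨s, hs, p, rfl⟩ := exists_eq_smul_coe hz
    rw [smul_smul, homExt_smul_coe U (mul_pos ht hs), homExt_smul_coe U hs, mul_assoc]

theorem homExt_comp_stereoMap (U : UnitSphere n → ℝ) (p : UnitSphere n) (y : Euc n) :
    homExt U (stereoMap p y) = U ((chartAt (Euc n) p).symm y) := by
  rw [← coe_chart_symm, homExt_coe]

theorem inChart_eq (U : UnitSphere n → ℝ) (p : UnitSphere n) :
    inChart U p = homExt U ∘ stereoMap p :=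
  funext fun y => (homExt_comp_stereoMap U p y).symm

theorem contDiff_inChart {U : UnitSphere n → ℝ} (hU : ContMDiff (𝓡 n) 𝓘(ℝ, ℝ) ∞ U)
    (p : UnitSphere n) : ContDiff ℝ ∞ (inChart (n := n) U p) :=
  have h : ContMDiff 𝓘(ℝ, Euc n) (𝓡 n) ∞ (chartAt (Euc n) p).symm :=
    (contMDiff_chart_symm p).of_le le_top
  (hU.comp h).contDiff

theorem chart_apply (p q : UnitSphere n) :
    haveI := Fact.mk (@finrank_euclideanSpace_fin ℝ _ (n + 1))
    chartAt (Euc n) p q = (OrthonormalBasis.fromOrthogonalSpanSingleton (𝕜 := ℝ) n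
      (ne_zero_of_mem_unit_sphere (-p))).repr
        (stereoToFun ((-p : UnitSphere n) : Euc (n + 1)) (q : Euc (n + 1))) :=
  rfl

/-- Near `z`, with `p = z / ‖z‖`, the extension is `‖w‖` times the coordinate expression of `U` at
the stereographic image of `w / ‖w‖`. The formula `stereoToFun` makes sense and is smooth on an open
subset of the ambient space, so no local extension of `U` has to be chosen. -/
theorem contDiffAt_homExt {U : UnitSphere n → ℝ} (hU : ContMDiff (𝓡 n) 𝓘(ℝ, ℝ) ∞ U)
    {z : Euc (n + 1)} (hz : z ≠ 0) : ContDiffAt ℝ ∞ (homExt U) z := by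
  have hfact := Fact.mk (@finrank_euclideanSpace_fin ℝ _ (n + 1))
  obtain ⟨t, ht, p, hp⟩ := exists_eq_smul_coe hz
  let v : Euc (n + 1) := ((-p : UnitSphere n) : Euc (n + 1))
  let e := (OrthonormalBasis.fromOrthogonalSpanSingleton (𝕜 := ℝ) n
      (ne_zero_of_mem_unit_sphere (-p))).repr
  let m : Euc (n + 1) → Euc (n + 1) := fun z => ‖z‖⁻¹ • z
  have hm : ContDiffAt ℝ ∞ m z :=
    ((contDiffAt_norm ℝ hz).inv (norm_ne_zero_iff.2 hz)).smul contDiffAt_id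
  have hmz : m z = p := by
    have : ‖z‖ = t := by
      rw [hp, norm_smul, norm_unitSphere, mul_one, Real.norm_of_nonneg ht.le]
    change ‖z‖⁻¹ • z = p
    rw [this, hp, smul_smul, inv_mul_cancel₀ ht.ne', one_smul]
  have hv : innerSL ℝ v (p : Euc (n + 1)) ≠ (1 : ℝ) := by
    change inner ℝ (-(p : Euc (n + 1))) (p : Euc (n + 1)) ≠ (1 : ℝ)
    rw [inner_neg_left, inner_self_unitSphere]
    norm_num
  have hopen : IsOpen {x : Euc (n + 1) | innerSL ℝ v x ≠ (1 : ℝ)} :=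
    isOpen_ne.preimage (innerSL ℝ v).continuous
  have hs : ContDiffAt ℝ ∞ (stereoToFun v) (m z) := by
    rw [hmz]
    exact contDiffOn_stereoToFun.contDiffAt (hopen.mem_nhds hv)
  have hmain : ContDiffAt ℝ ∞
      (fun z => ‖z‖ * inChart U p (e (stereoToFun v (m z)))) z :=
    (contDiffAt_norm ℝ hz).mul ((contDiff_inChart hU p).contDiffAt.comp z
      (e.contDiff.contDiffAt.comp z (hs.comp z hm)))
  refine hmain.congr_of_eventuallyEq ?_
  have h1 : ∀ᶠ w in 𝓝 z, m w ∈ {x : Euc (n + 1) | innerSL ℝ v x ≠ (1 : ℝ)} :=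
    hm.continuousAt (hopen.mem_nhds (by rw [hmz]; exact hv))
  filter_upwards [h1, isOpen_ne.mem_nhds hz] with w hw hw0
  rw [homExt, dif_pos hw0]
  congr 1
  set q : UnitSphere n := ⟨‖w‖⁻¹ • w, normalize_mem hw0⟩
  have hq : q ∈ (chartAt (Euc n) p).source := by
    rw [chart_source]
    rintro (h : q = -p)
    refine hw ?_
    have : m w = v := congrArg Subtype.val h
    rw [this]
    exact inner_self_unitSphere (-p)
  have hchart : chartAt (Euc n) p q = e (stereoToFun v (m w)) := chart_apply p q
  change U q = inChart (n := n) U p (e (stereoToFun v (m w)))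
  rw [← hchart, inChart, Function.comp_apply, (chartAt (Euc n) p).left_inv hq]

theorem differentiableAt_homExt {U : UnitSphere n → ℝ} (hU : ContMDiff (𝓡 n) 𝓘(ℝ, ℝ) ∞ U)
    {z : Euc (n + 1)} (hz : z ≠ 0) : DifferentiableAt ℝ (homExt U) z :=
  (contDiffAt_homExt hU hz).differentiableAt (by simp)

theorem contDiffAt_fderiv_homExt {U : UnitSphere n → ℝ} (hU : ContMDiff (𝓡 n) 𝓘(ℝ, ℝ) ∞ U)
    {z : Euc (n + 1)} (hz : z ≠ 0) : ContDiffAt ℝ ∞ (fderiv ℝ (homExt U)) z :=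
  (contDiffAt_homExt hU hz).fderiv_right (by simp)

theorem differentiableAt_fderiv_homExt {U : UnitSphere n → ℝ}
    (hU : ContMDiff (𝓡 n) 𝓘(ℝ, ℝ) ∞ U) {z : Euc (n + 1)} (hz : z ≠ 0) :
    DifferentiableAt ℝ (fderiv ℝ (homExt U)) z :=
  (contDiffAt_fderiv_homExt hU hz).differentiableAt (by simp)

/-- Euler's identity. -/
theorem fderiv_homExt_self {U : UnitSphere n → ℝ} (hU : ContMDiff (𝓡 n) 𝓘(ℝ, ℝ) ∞ U)
    (p : UnitSphere n) : fderiv ℝ (homExt U) p p = U p := by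
  have h1 : HasDerivAt (fun t : ℝ => t • (p : Euc (n + 1))) (p : Euc (n + 1)) 1 := by
    simpa using (hasDerivAt_id (1 : ℝ)).smul_const (p : Euc (n + 1))
  have h2 : HasDerivAt (fun t : ℝ => homExt U (t • (p : Euc (n + 1))))
      (fderiv ℝ (homExt U) p p) 1 := by
    exact (differentiableAt_homExt hU (unitSphere_ne_zero p)).hasFDerivAt.comp_hasDerivAt_of_eq
      1 h1 (one_smul ℝ _).symm
  have h3 : HasDerivAt (fun t : ℝ => t * U p) (U p) 1 := by
    simpa using (hasDerivAt_id (1 : ℝ)).mul_const (U p)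
  refine h2.unique (h3.congr_of_eventuallyEq ?_)
  filter_upwards [lt_mem_nhds one_pos] with t ht
  exact homExt_smul_coe U ht p

theorem fderiv_homExt_smul (U : UnitSphere n → ℝ) {t : ℝ} (ht : 0 < t) (z : Euc (n + 1)) :
    fderiv ℝ (homExt U) (t • z) = fderiv ℝ (homExt U) z := by
  have h1 : fderiv ℝ (fun x => homExt U (t • x)) z = t • fderiv ℝ (homExt U) (t • z) :=
    fderiv_comp_smul t
  have h2 : (fun x => homExt U (t • x)) = fun x => t • homExt U x :=
    funext fun x => homExt_smul U ht x
  have hinv : Invertible t := invertibleOfNonzero ht.ne'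
  have h3 : fderiv ℝ (fun x => t • homExt U x) z = t • fderiv ℝ (homExt U) z :=
    fderiv_const_smul_of_invertible t
  rw [h2, h3] at h1
  exact (smul_right_injective _ ht.ne' h1).symm

/-- The gradient is homogeneous of degree zero, hence constant along the ray through `p`. -/
theorem hessian_homExt_self {U : UnitSphere n → ℝ} (hU : ContMDiff (𝓡 n) 𝓘(ℝ, ℝ) ∞ U)
    (p : UnitSphere n) : fderiv ℝ (fderiv ℝ (homExt U)) p p = 0 := by
  have h1 : HasDerivAt (fun t : ℝ => t • (p : Euc (n + 1))) (p : Euc (n + 1)) 1 := by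
    simpa using (hasDerivAt_id (1 : ℝ)).smul_const (p : Euc (n + 1))
  have h2 : HasDerivAt (fun t : ℝ => fderiv ℝ (homExt U) (t • (p : Euc (n + 1))))
      (fderiv ℝ (fderiv ℝ (homExt U)) p p) 1 := by
    exact (differentiableAt_fderiv_homExt hU
      (unitSphere_ne_zero p)).hasFDerivAt.comp_hasDerivAt_of_eq 1 h1 (one_smul ℝ _).symm
  refine h2.unique ((hasDerivAt_const (1 : ℝ) (fderiv ℝ (homExt U) p)).congr_of_eventuallyEq ?_)
  filter_upwards [lt_mem_nhds one_pos] with t ht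
  exact fderiv_homExt_smul U ht p

theorem hessian_homExt_symm {U : UnitSphere n → ℝ} (hU : ContMDiff (𝓡 n) 𝓘(ℝ, ℝ) ∞ U)
    {z : Euc (n + 1)} (hz : z ≠ 0) (v w : Euc (n + 1)) :
    fderiv ℝ (fderiv ℝ (homExt U)) z v w = fderiv ℝ (fderiv ℝ (homExt U)) z w v :=
  ((contDiffAt_homExt hU hz).isSymmSndFDerivAt (by simpa using WithTop.coe_le_coe.2 (le_top : (2 : ℕ∞) ≤ ⊤))) v w

/-! ### The Hessian on the sphere in terms of the homogeneous extension -/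

theorem fderiv_inChart {U : UnitSphere n → ℝ} (hU : ContMDiff (𝓡 n) 𝓘(ℝ, ℝ) ∞ U)
    (p : UnitSphere n) (y v : Euc n) :
    fderiv ℝ (inChart U p) y v =
      fderiv ℝ (homExt U) (stereoMap p y) (fderiv ℝ (stereoMap p) y v) := by
  rw [inChart_eq, fderiv_comp y (differentiableAt_homExt hU (stereoMap_ne_zero p y))
    (hasFDerivAt_stereoMap p y).differentiableAt]
  rfl

theorem fderiv_inChart_zero {U : UnitSphere n → ℝ} (hU : ContMDiff (𝓡 n) 𝓘(ℝ, ℝ) ∞ U)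
    (p : UnitSphere n) (v : Euc n) :
    fderiv ℝ (inChart U p) 0 v = fderiv ℝ (homExt U) p (tangentFrame p v) := by
  rw [fderiv_inChart hU, stereoMap_zero, fderiv_stereoMap_zero]

theorem hasFDerivAt_fderiv_stereoMap_zero (p : UnitSphere n) (w : Euc n) :
    HasFDerivAt (fun y => fderiv ℝ (stereoMap p) y w)
      ((-innerSL ℝ w).smulRight (p : Euc (n + 1))) 0 := by
  have h1 := ((hasFDerivAt_stereoFactor (0 : Euc n)).mul_const 4).smul_const (tangentFrame p w)
  have h2 := ((hasFDerivAt_stereoFactor (0 : Euc n)).pow 2).const_mul 2 |>.neg.mul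
    ((innerSL ℝ w).hasFDerivAt (x := (0 : Euc n)))
  have h3 : HasFDerivAt (fun y => (4 : ℝ) • tangentFrame p y + (8 : ℝ) • (p : Euc (n + 1)))
      ((4 : ℝ) • (tangentFrame p).toContinuousLinearMap) 0 :=
    (((tangentFrame p).toContinuousLinearMap.hasFDerivAt (x := 0)).const_smul (4 : ℝ)).add_const _
  have h4 := h1.add (h2.smul h3)
  refine (h4.congr_of_eventuallyEq (Filter.Eventually.of_forall fun y => ?_)).congr_fderiv ?_
  · rw [fderiv_stereoMap_apply, real_inner_comm]
    rfl
  · ext1 v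
    simp [stereoFactor_zero]
    match_scalars
    ring

/-- The second derivative of `stereoMap p` at the origin is `-⟨v, w⟩ p`; by Euler's identity it
contributes `-U p * ⟨v, w⟩` to the chain rule. Thus `D²(homExt U) = Hess U + U g` on tangent
vectors. -/
theorem fderiv_fderiv_inChart_zero {U : UnitSphere n → ℝ} (hU : ContMDiff (𝓡 n) 𝓘(ℝ, ℝ) ∞ U)
    (p : UnitSphere n) (v w : Euc n) :
    fderiv ℝ (fun y => fderiv ℝ (inChart U p) y w) 0 v =
      fderiv ℝ (fderiv ℝ (homExt U)) p (tangentFrame p v) (tangentFrame p w) -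
        U p * inner ℝ v w := by
  have h1 : HasFDerivAt (fderiv ℝ (homExt U)) (fderiv ℝ (fderiv ℝ (homExt U)) p)
      (stereoMap p 0) := by
    rw [stereoMap_zero]
    exact (differentiableAt_fderiv_homExt hU (unitSphere_ne_zero p)).hasFDerivAt
  have h2 := (h1.comp 0 (hasFDerivAt_stereoMap p 0)).clm_apply
    (hasFDerivAt_fderiv_stereoMap_zero p w)
  have h3 : (fun y => fderiv ℝ (inChart U p) y w) = fun y =>
      (fderiv ℝ (homExt U) ∘ stereoMap p) y (fderiv ℝ (stereoMap p) y w) :=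
    funext fun y => fderiv_inChart hU p y w
  rw [h3, h2.fderiv]
  simp [fderiv_stereoMap_zero, stereoFactor_zero, stereoMap_zero, fderiv_homExt_self hU,
    real_inner_comm w v]
  ring

/-- The trace of the Hessian of the homogeneous extension. -/
def hessTrace (U : UnitSphere n → ℝ) (p : UnitSphere n) : ℝ :=
  ∑ i : Fin n, fderiv ℝ (fderiv ℝ (homExt U)) p (tangentFrame p (basisVec i))
    (tangentFrame p (basisVec i))

theorem sum_smul_basisVec (v : Euc n) : ∑ i, v i • basisVec i = v := by
  have := (EuclideanSpace.basisFun (Fin n) ℝ).sum_repr v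
  simpa using this

theorem sum_bilin (B : Euc n →L[ℝ] Euc n →L[ℝ] ℝ) (v w : Euc n) :
    ∑ i, ∑ j, v i * w j * B (basisVec i) (basisVec j) = B v w := by
  conv_rhs => rw [← sum_smul_basisVec v, ← sum_smul_basisVec w]
  simp only [map_sum, map_smul, sum_apply, smul_apply, smul_eq_mul,
    Finset.mul_sum]
  rw [Finset.sum_comm]
  exact Finset.sum_congr rfl fun i _ => Finset.sum_congr rfl fun j _ => by ring

theorem inner_basisVec (i j : Fin n) :
    inner ℝ (basisVec i) (basisVec j) = if i = j then (1 : ℝ) else 0 := by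
  simp [EuclideanSpace.inner_single_left]

/-- `ΔU = hessTrace U - n U` and `Ric = (n - 1) g`, so the coefficients of `U g` add up to `n - 1 -
(n - 1) = 0`. -/
theorem LStar_roundMetric {U : UnitSphere n → ℝ} (hU : ContMDiff (𝓡 n) 𝓘(ℝ, ℝ) ∞ U)
    (p : UnitSphere n) (v w : Euc n) :
    LStar (roundMetric n) U p v w =
      fderiv ℝ (fderiv ℝ (homExt U)) p (tangentFrame p v) (tangentFrame p w) -
        hessTrace U p * inner ℝ v w := by
  set B : Euc n →L[ℝ] Euc n →L[ℝ] ℝ :=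
    (fderiv ℝ (fderiv ℝ (homExt U)) (p : Euc (n + 1))).bilinearComp
      (tangentFrame p).toContinuousLinearMap (tangentFrame p).toContinuousLinearMap
  set I : Euc n →L[ℝ] Euc n →L[ℝ] ℝ := innerSL ℝ
  have hH : ∀ i j, hessCoord (metricCoord (roundMetric n) p) (inChart U p) i j
      (chartAt (Euc n) p p) = B (basisVec i) (basisVec j) - U p * I (basisVec i) (basisVec j) := by
    intro i j
    rw [chart_self, hessCoord_roundMetric]
    exact fderiv_fderiv_inChart_zero hU p _ _
  have hess_eq : hess (roundMetric n) U p v w = B v w - U p * I v w := by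
    rw [← sum_bilin B, ← sum_bilin I, Finset.mul_sum, ← Finset.sum_sub_distrib]
    refine Finset.sum_congr rfl fun i _ => ?_
    rw [Finset.mul_sum, ← Finset.sum_sub_distrib]
    refine Finset.sum_congr rfl fun j _ => ?_
    rw [hH]
    change v i * w j * _ = _
    ring
  have lap_eq : laplacian (roundMetric n) U p = hessTrace U p - n * U p := by
    rw [laplacian, chart_self, metricCoord_roundMetric_zero, inv_one]
    simp only [← chart_self p, hH, Matrix.one_apply, ite_mul, one_mul, zero_mul,
      Finset.sum_ite_eq, Finset.mem_univ, if_true, Finset.sum_sub_distrib]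
    have hI : ∀ i : Fin n, I (basisVec i) (basisVec i) = 1 := fun i =>
      (inner_basisVec i i).trans (if_pos rfl)
    simp only [hI, mul_one, Finset.sum_const, Finset.card_univ, Fintype.card_fin, nsmul_eq_mul]
    rfl
  have ric_eq : ric (roundMetric n) p v w = (n - 1) * I v w := by
    rw [← sum_bilin I]
    change ∑ i, ∑ j, v i * w j *
      ricciCoord (metricCoord (roundMetric n) p) i j (chartAt (Euc n) p p) = _
    rw [chart_self]
    simp only [ricciCoord_roundMetric, Finset.mul_sum]
    refine Finset.sum_congr rfl fun i _ => Finset.sum_congr rfl fun j _ => ?_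
    change v i * w j * _ = (n - 1) * (v i * w j * inner ℝ (basisVec i) (basisVec j))
    rw [inner_basisVec]
    split_ifs <;> ring
  change -(laplacian (roundMetric n) U p) * (roundMetric n).inner p v w +
    hess (roundMetric n) U p v w - U p * ric (roundMetric n) p v w = _
  rw [hess_eq, lap_eq, ric_eq, show (roundMetric n).inner p v w = I v w from
    roundMetric_inner p v w]
  change _ = B v w - _ * I v w
  ring

/-- On tangent vectors `D²F` is `hessTrace U` times the metric; its trace gives `hessTrace U = n *
hessTrace U`, which forces zero as `n ≠ 1`. The radial direction is covered by `hessian_homExt_self`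
and symmetry. -/
theorem forall_LStar_eq_zero_iff (hn : 2 ≤ n) {U : UnitSphere n → ℝ}
    (hU : ContMDiff (𝓡 n) 𝓘(ℝ, ℝ) ∞ U) (p : UnitSphere n) :
    (∀ v w : TangentSpace (𝓡 n) p, LStar (roundMetric n) U p v w = 0) ↔
      fderiv ℝ (fderiv ℝ (homExt U)) p = 0 := by
  constructor
  · intro h
    have h1 : ∀ v w : Euc n,
        fderiv ℝ (fderiv ℝ (homExt U)) p (tangentFrame p v) (tangentFrame p w) =
          hessTrace U p * inner ℝ v w := fun v w => by
      have := h v w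
      rw [LStar_roundMetric hU] at this
      linarith
    have h2 : hessTrace U p = n * hessTrace U p := by
      conv_lhs => rw [hessTrace]
      simp [h1]
    have h3 : hessTrace U p = 0 := by
      have : (2 : ℝ) ≤ n := by exact_mod_cast hn
      have h4 : (n - 1 : ℝ) * hessTrace U p = 0 := by linarith
      rcases mul_eq_zero.1 h4 with h5 | h5
      · linarith
      · exact h5
    have key : ∀ v w : Euc (n + 1), fderiv ℝ (fderiv ℝ (homExt U)) p v w = 0 := by
      have hp := hessian_homExt_self hU p
      have hs := hessian_homExt_symm hU (unitSphere_ne_zero p)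
      have hdec : ∀ v : Euc (n + 1), ∃ (c : ℝ) (x : Euc n),
          v = c • (p : Euc (n + 1)) + tangentFrame p x := by
        intro v
        exact ⟨_, exists_eq_smul_add_frame p v⟩
      intro v w
      obtain ⟨c, x, rfl⟩ := hdec v
      obtain ⟨d, y, rfl⟩ := hdec w
      simp only [map_add, map_smul, add_apply, smul_apply, hp, hs _ (p : Euc (n + 1)), h1, h3]
      simp
    ext v w
    exact key v w
  · intro h v w
    refine (LStar_roundMetric hU p v w).trans ?_
    rw [hessTrace, h]
    simp

/-- Solutions of `L*u = 0` on a connected open set are linear. -/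
theorem exists_fderiv_homExt_eq (hn : 2 ≤ n) {U : UnitSphere n → ℝ}
    (hU : ContMDiff (𝓡 n) 𝓘(ℝ, ℝ) ∞ U) {Ω : Set (UnitSphere n)} (ho : IsOpen Ω)
    (hc : IsPreconnected Ω)
    (hL : ∀ p ∈ Ω, ∀ v w : TangentSpace (𝓡 n) p, LStar (roundMetric n) U p v w = 0) :
    ∃ a : Euc (n + 1), ∀ x ∈ closure Ω, fderiv ℝ (homExt U) x = innerSL ℝ a := by
  set G : UnitSphere n → (Euc (n + 1) →L[ℝ] ℝ) := fun x => fderiv ℝ (homExt U) x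
  have hG : Continuous G := continuous_iff_continuousAt.2 fun x =>
    (contDiffAt_fderiv_homExt hU (unitSphere_ne_zero x)).continuousAt.comp
      continuous_subtype_val.continuousAt
  have hloc : ∀ p ∈ Ω, ∀ᶠ q in 𝓝[Ω] p, G p = G q := by
    intro p hp
    set φ := chartAt (Euc n) p
    have h0 : φ.symm ⁻¹' Ω ∈ 𝓝 (0 : Euc n) := by
      refine (contMDiff_chart_symm p).continuous.continuousAt ?_
      rw [chart_symm_zero]
      exact ho.mem_nhds hp
    obtain ⟨r, hr, hball⟩ := Metric.mem_nhds_iff.1 h0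
    have hconst : ∀ y ∈ Metric.ball (0 : Euc n) r, G p = G (φ.symm y) := by
      intro y hy
      have hd : ∀ y ∈ Metric.ball (0 : Euc n) r,
          HasFDerivAt (fun y => G (φ.symm y)) (0 : Euc n →L[ℝ] _) y := by
        intro y hy
        have h1 : fderiv ℝ (fderiv ℝ (homExt U)) (stereoMap p y) = 0 := by
          rw [← coe_chart_symm]
          exact (forall_LStar_eq_zero_iff hn hU _).1 (hL _ (hball hy))
        have h2 := (differentiableAt_fderiv_homExt hU (stereoMap_ne_zero p y)).hasFDerivAt
        rw [h1] at h2
        have h3 := h2.comp y (hasFDerivAt_stereoMap p y)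
        rw [ContinuousLinearMap.zero_comp] at h3
        refine h3.congr_of_eventuallyEq (Filter.Eventually.of_forall fun y => ?_)
        change fderiv ℝ (homExt U) (φ.symm y).1 = fderiv ℝ (homExt U) (stereoMap p y)
        rw [coe_chart_symm]
      have h4 := (convex_ball (0 : Euc n) r).is_const_of_fderivWithin_eq_zero (𝕜 := ℝ)
        (f := fun y => G (φ.symm y))
        (fun y hy => (hd y hy).differentiableAt.differentiableWithinAt)
        (fun y hy => (hd y hy).hasFDerivWithinAt.fderivWithin
          (Metric.isOpen_ball.uniqueDiffWithinAt hy)) (Metric.mem_ball_self hr) hy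
      simpa [φ, chart_symm_zero] using h4
    refine mem_nhdsWithin_of_mem_nhds ?_
    have h5 : ∀ᶠ q in 𝓝 p, φ q ∈ Metric.ball (0 : Euc n) r := by
      refine φ.continuousAt (mem_chart_source _ p) (Metric.isOpen_ball.mem_nhds ?_)
      rw [chart_self]
      exact Metric.mem_ball_self hr
    filter_upwards [h5, chart_source_mem_nhds (Euc n) p] with q hq hq2
    rw [hconst _ hq, φ.left_inv hq2]
  rcases Ω.eq_empty_or_nonempty with rfl | ⟨p, hp⟩
  · simp
  have hconst : ∀ q ∈ Ω, G q = G p := fun q hq =>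
    (hc.induction₂ (fun x y => G x = G y) hloc (fun x y z _ _ _ => Eq.trans)
      (fun x y _ _ => Eq.symm) hp hq).symm
  obtain ⟨a, ha⟩ := (InnerProductSpace.toDual ℝ (Euc (n + 1))).surjective (G p)
  refine ⟨a, fun x hx => ?_⟩
  -- The boundary condition uses first derivatives at boundary points, so the constancy has to pass
  -- to the closure.
  have hcl : closure Ω ⊆ {x | G x = G p} :=
    closure_minimal hconst (isClosed_eq hG continuous_const)
  rw [show fderiv ℝ (homExt U) x = G p from hcl hx, ← ha]
  rfl

theorem eq_inner_of_fderiv_homExt_eq {U : UnitSphere n → ℝ} (hU : ContMDiff (𝓡 n) 𝓘(ℝ, ℝ) ∞ U)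
    {x : UnitSphere n} {a : Euc (n + 1)} (h : fderiv ℝ (homExt U) x = innerSL ℝ a) :
    U x = inner ℝ a (x : Euc (n + 1)) := by
  rw [← fderiv_homExt_self hU, h]
  rfl

/-! ### Linear functions -/

theorem contMDiff_linear (a : Euc (n + 1)) : ContMDiff (𝓡 n) 𝓘(ℝ, ℝ) ∞
    (fun x : UnitSphere n => (inner ℝ a (x : Euc (n + 1)) : ℝ)) :=
  ((innerSL ℝ a).contDiff.contMDiff).comp (contMDiff_coe.of_le (by simp))

theorem homExt_linear (a : Euc (n + 1)) :
    homExt (fun x : UnitSphere n => (inner ℝ a (x : Euc (n + 1)) : ℝ)) = innerSL ℝ a := by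
  ext z
  by_cases hz : z = 0
  · simp [hz, homExt]
  · obtain ⟨t, ht, p, rfl⟩ := exists_eq_smul_coe hz
    rw [homExt_smul_coe _ ht]
    simp

theorem fderiv_homExt_linear (a z : Euc (n + 1)) :
    fderiv ℝ (homExt (fun x : UnitSphere n => (inner ℝ a (x : Euc (n + 1)) : ℝ))) z =
      innerSL ℝ a := by
  rw [homExt_linear, ContinuousLinearMap.fderiv]

/-! ### Defining functions of the boundary -/

section Boundary

variable {Ω : Set (UnitSphere n)} {p : UnitSphere n} {ρ : UnitSphere n → ℝ}

theorem mvfderiv_eq_fderiv_inChart (hρ : ContMDiff (𝓡 n) 𝓘(ℝ, ℝ) ∞ ρ) (p : UnitSphere n)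
    (v : TangentSpace (𝓡 n) p) :
    mvfderiv (𝓡 n) ρ p v = fderiv ℝ (inChart (n := n) ρ p) 0 (show Euc n from v) :=
  mvfderiv_eq_fderiv_chart p (hρ.mdifferentiable (by simp) p) v

theorem mvfderiv_eq_fderiv_homExt (hρ : ContMDiff (𝓡 n) 𝓘(ℝ, ℝ) ∞ ρ) (p : UnitSphere n)
    (v : TangentSpace (𝓡 n) p) :
    mvfderiv (𝓡 n) ρ p v = fderiv ℝ (homExt ρ) p (tangentFrame p (show Euc n from v)) :=
  (mvfderiv_eq_fderiv_inChart hρ p v).trans (fderiv_inChart_zero hρ p _)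

theorem tendsto_chart_symm_smul (p : UnitSphere n) (v : Euc n) :
    Filter.Tendsto (fun t : ℝ => (chartAt (Euc n) p).symm (t • v)) (𝓝[>] 0) (𝓝 p) := by
  have h : Filter.Tendsto (fun t : ℝ => (chartAt (Euc n) p).symm (t • v)) (𝓝 0)
      (𝓝 ((chartAt (Euc n) p).symm ((0 : ℝ) • v))) :=
    ((contMDiff_chart_symm p).continuous.comp (continuous_id.smul continuous_const)).tendsto 0
  rw [zero_smul, chart_symm_zero] at h
  exact h.mono_left nhdsWithin_le_nhds

theorem eventually_neg_of_fderiv_neg (hρ : ContMDiff (𝓡 n) 𝓘(ℝ, ℝ) ∞ ρ) (h0 : ρ p = 0)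
    {v : Euc n} (hv : fderiv ℝ (inChart (n := n) ρ p) 0 v < 0) :
    ∀ᶠ t : ℝ in 𝓝[>] 0, ρ ((chartAt (Euc n) p).symm (t • v)) < 0 := by
  have h1 : HasDerivAt (fun t : ℝ => t • v) v 0 := by
    simpa using (hasDerivAt_id (0 : ℝ)).smul_const v
  have h2 : HasDerivAt (fun t : ℝ => inChart (n := n) ρ p (t • v))
      (fderiv ℝ (inChart (n := n) ρ p) 0 v) 0 :=
    ((contDiff_inChart hρ p).differentiable (by simp) 0).hasFDerivAt.comp_hasDerivAt_of_eq 0 h1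
      (zero_smul ℝ v).symm
  have h3 := (hasDerivAt_iff_tendsto_slope.1 h2).eventually (gt_mem_nhds hv)
  have h4 : 𝓝[>] (0 : ℝ) ≤ 𝓝[≠] 0 := nhdsWithin_mono _ fun t ht => ne_of_gt ht
  filter_upwards [h4 h3, self_mem_nhdsWithin] with t ht htpos
  rw [slope_def_field] at ht
  have h5 : inChart (n := n) ρ p ((0 : ℝ) • v) = 0 := by
    rw [zero_smul, inChart, Function.comp_apply, chart_symm_zero, h0]
  rw [h5, sub_zero, sub_zero] at ht
  have htpos : (0 : ℝ) < t := htpos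
  by_contra hcon
  exact absurd ht (not_lt.2 (div_nonneg (not_lt.1 hcon) htpos.le))

/-- If `dρ(v) < 0 < dρ'(v)`, then points slightly along `v` satisfy `ρ < 0 < ρ'` and would lie both
in `Ω` and outside it. Tangency and outwardness quantify over all defining functions; this
comparison reduces them to a single one. -/
theorem IsDefiningFunction.fderiv_nonpos {ρ' : UnitSphere n → ℝ}
    (h : IsDefiningFunction n Ω p ρ) (h' : IsDefiningFunction n Ω p ρ') {v : Euc n}
    (hv : fderiv ℝ (inChart (n := n) ρ p) 0 v < 0) :
    fderiv ℝ (inChart (n := n) ρ' p) 0 v ≤ 0 := by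
  by_contra! hcon
  have h1 := eventually_neg_of_fderiv_neg h.1 h.2.1 hv
  have hneg : ContMDiff (𝓡 n) 𝓘(ℝ, ℝ) ∞ (-ρ') := h'.1.neg
  have h2 := eventually_neg_of_fderiv_neg (p := p) hneg (v := v) (by simp [h'.2.1]) (by
    have : inChart (n := n) (-ρ') p = -inChart (n := n) ρ' p := rfl
    rw [this, fderiv_neg]
    simpa using hcon)
  have ht := tendsto_chart_symm_smul p v
  obtain ⟨t, h1, h2, h3, h4⟩ := (h1.and (h2.and ((ht.eventually h.2.2.2).and
    (ht.eventually h'.2.2.2)))).exists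
  have := h4.1 (h3.2 h1)
  simp only [Pi.neg_apply] at h2
  linarith

theorem IsDefiningFunction.exists_fderiv_neg (h : IsDefiningFunction n Ω p ρ) :
    ∃ v : Euc n, fderiv ℝ (inChart (n := n) ρ p) 0 v < 0 := by
  obtain ⟨w, hw⟩ : ∃ w : TangentSpace (𝓡 n) p, mvfderiv (𝓡 n) ρ p w ≠ 0 := by
    by_contra! hcon
    exact h.2.2.1 (ContinuousLinearMap.ext hcon)
  rw [mvfderiv_eq_fderiv_inChart h.1] at hw
  rcases lt_or_gt_of_ne hw with h1 | h1
  · exact ⟨_, h1⟩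
  · refine ⟨-(show Euc n from w), ?_⟩
    rw [map_neg]
    exact neg_neg_of_pos h1

/-- For `dρ(w) < 0`, the strict case applies to `v + ε w`; let `ε → 0`, and repeat with `-v`. -/
theorem IsDefiningFunction.fderiv_eq_zero {ρ' : UnitSphere n → ℝ}
    (h : IsDefiningFunction n Ω p ρ) (h' : IsDefiningFunction n Ω p ρ') {v : Euc n}
    (hv : fderiv ℝ (inChart (n := n) ρ p) 0 v = 0) :
    fderiv ℝ (inChart (n := n) ρ' p) 0 v = 0 := by
  obtain ⟨w, hw⟩ := h.exists_fderiv_neg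
  have key : ∀ v : Euc n, fderiv ℝ (inChart (n := n) ρ p) 0 v = 0 →
      fderiv ℝ (inChart (n := n) ρ' p) 0 v ≤ 0 := by
    intro v hv
    have h1 : ∀ ε : ℝ, 0 < ε → fderiv ℝ (inChart (n := n) ρ' p) 0 v +
        ε * fderiv ℝ (inChart (n := n) ρ' p) 0 w ≤ 0 := by
      intro ε hε
      have := h.fderiv_nonpos h' (v := v + ε • w) (by
        rw [map_add, map_smul, hv, zero_add]
        exact mul_neg_of_pos_of_neg hε hw)
      rwa [map_add, map_smul] at this
    have h2 : Filter.Tendsto (fun ε : ℝ => fderiv ℝ (inChart (n := n) ρ' p) 0 v +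
        ε * fderiv ℝ (inChart (n := n) ρ' p) 0 w) (𝓝[>] 0)
        (𝓝 (fderiv ℝ (inChart (n := n) ρ' p) 0 v +
        0 * fderiv ℝ (inChart (n := n) ρ' p) 0 w)) :=
      (Continuous.tendsto (by fun_prop) 0).mono_left nhdsWithin_le_nhds
    rw [zero_mul, add_zero] at h2
    exact le_of_tendsto h2 (by filter_upwards [self_mem_nhdsWithin] with ε hε using h1 ε hε)
  refine le_antisymm (key v hv) ?_
  have := key (-v) (by rw [map_neg, hv, neg_zero])
  rw [map_neg] at this
  linarith

theorem IsDefiningFunction.fderiv_pos {ρ' : UnitSphere n → ℝ}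
    (h : IsDefiningFunction n Ω p ρ) (h' : IsDefiningFunction n Ω p ρ') {v : Euc n}
    (hv : 0 < fderiv ℝ (inChart (n := n) ρ p) 0 v) :
    0 < fderiv ℝ (inChart (n := n) ρ' p) 0 v := by
  have h1 := h.fderiv_nonpos h' (v := -v) (by rw [map_neg]; linarith)
  rw [map_neg] at h1
  refine lt_of_le_of_ne (by linarith) fun h2 => ?_
  exact hv.ne' (h'.fderiv_eq_zero h h2.symm)

theorem IsDefiningFunction.isTangentToBoundary_iff (h : IsDefiningFunction n Ω p ρ)
    (v : TangentSpace (𝓡 n) p) :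
    IsTangentToBoundary Ω p v ↔ mvfderiv (𝓡 n) ρ p v = 0 := by
  refine ⟨fun hv => hv ρ h, fun hv ρ' h' => ?_⟩
  rw [mvfderiv_eq_fderiv_inChart h'.1]
  rw [mvfderiv_eq_fderiv_inChart h.1] at hv
  exact h.fderiv_eq_zero h' hv

theorem IsDefiningFunction.mem_frontier (h : IsDefiningFunction n Ω p ρ) (ho : IsOpen Ω) :
    p ∈ frontier Ω := by
  rw [ho.frontier_eq]
  obtain ⟨v, hv⟩ := h.exists_fderiv_neg
  refine ⟨?_, fun hp => absurd (h.2.2.2.self_of_nhds.1 hp) (by rw [h.2.1]; exact lt_irrefl _)⟩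
  have ht := tendsto_chart_symm_smul p v
  refine mem_closure_of_tendsto ht ?_
  filter_upwards [ht.eventually h.2.2.2, eventually_neg_of_fderiv_neg h.1 h.2.1 hv] with t h1 h2
  exact h1.2 h2

theorem eq_zero_of_mem_frontier (ho : IsOpen Ω) (hρ : Continuous ρ)
    (h : ∀ᶠ x in 𝓝 p, (x ∈ Ω ↔ ρ x < 0)) (hp : p ∈ frontier Ω) : ρ p = 0 := by
  rw [ho.frontier_eq] at hp
  refine le_antisymm ?_ (not_lt.1 fun hlt => hp.2 (h.self_of_nhds.2 hlt))
  by_contra! hcon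
  have h1 := hρ.continuousAt.eventually (lt_mem_nhds hcon)
  obtain ⟨x, hx, h2, h3⟩ := ((mem_closure_iff_frequently.1 hp.1).and_eventually (h1.and h)).exists
  exact absurd (h3.1 hx) (not_lt.2 h2.le)

theorem fderiv_homExt_ne_zero (h : IsDefiningFunction n Ω p ρ) :
    fderiv ℝ (homExt ρ) p ≠ 0 := by
  intro h0
  obtain ⟨v, hv⟩ := h.exists_fderiv_neg
  rw [fderiv_inChart_zero h.1, h0] at hv
  exact lt_irrefl _ hv

/-- A defining function near `p` is a defining function near all boundary points close to `p`. -/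
theorem IsDefiningFunction.eventually (h : IsDefiningFunction n Ω p ρ) (ho : IsOpen Ω) :
    ∀ᶠ q in 𝓝 p, (q ∈ frontier Ω ↔ ρ q = 0) ∧ (ρ q = 0 → IsDefiningFunction n Ω q ρ) := by
  have h1 : ContinuousAt (fun q : UnitSphere n => fderiv ℝ (homExt ρ) q) p :=
    (contDiffAt_fderiv_homExt h.1 (unitSphere_ne_zero p)).continuousAt.comp
      continuous_subtype_val.continuousAt
  filter_upwards [h.2.2.2.eventually_nhds, h1 (isOpen_ne.mem_nhds (fderiv_homExt_ne_zero h))]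
    with q hq hq1
  have hdef : ρ q = 0 → IsDefiningFunction n Ω q ρ := by
    intro h0
    refine ⟨h.1, h0, fun hd => hq1 ?_, hq⟩
    have h2 : ∀ v : Euc n, fderiv ℝ (homExt ρ) q (tangentFrame q v) = 0 := fun v => by
      have := mvfderiv_eq_fderiv_homExt h.1 q v
      rw [hd] at this
      exact this.symm
    change fderiv ℝ (homExt ρ) q = 0
    ext v
    -- Only tangential derivatives are known to vanish; the radial one equals `ρ q = 0` by Euler's
    -- identity.
    obtain ⟨x, hx⟩ := exists_frame_eq q
      (w := v - (inner ℝ (q : Euc (n + 1)) v : ℝ) • (q : Euc (n + 1))) (by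
        rw [inner_sub_right, inner_smul_right, inner_self_unitSphere]; ring)
    have h3 := h2 x
    rw [hx, map_sub, map_smul, fderiv_homExt_self h.1, h0, smul_zero, sub_zero] at h3
    exact h3
  exact ⟨⟨eq_zero_of_mem_frontier ho h.1.continuous hq, fun h0 => (hdef h0).mem_frontier ho⟩, hdef⟩

/-! ### Vector fields in the chart -/

theorem mfderiv_chart_eq (p q : UnitSphere n) (hq : q ∈ (chartAt (Euc n) p).source)
    (v : TangentSpace (𝓡 n) q) :
    mfderiv (𝓡 n) (𝓡 n) (chartAt (Euc n) p) q v =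
      (trivializationAt (Euc n) (TangentSpace (𝓡 n)) p).continuousLinearMapAt ℝ q v := by
  rw [TangentBundle.continuousLinearMapAt_trivializationAt hq]
  rfl

theorem mvfderiv_eq_fderiv_mfderiv (hρ : ContMDiff (𝓡 n) 𝓘(ℝ, ℝ) ∞ ρ) (p q : UnitSphere n)
    (hq : q ∈ (chartAt (Euc n) p).source) (v : TangentSpace (𝓡 n) q) :
    mvfderiv (𝓡 n) ρ q v = fderiv ℝ (inChart (n := n) ρ p) (chartAt (Euc n) p q)
      (mfderiv (𝓡 n) (𝓡 n) (chartAt (Euc n) p) q v) := by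
  have h1 : ρ =ᶠ[𝓝 q] inChart (n := n) ρ p ∘ chartAt (Euc n) p := by
    filter_upwards [(chartAt (Euc n) p).open_source.mem_nhds hq] with x hx
    rw [inChart, Function.comp_apply, Function.comp_apply, (chartAt (Euc n) p).left_inv hx]
  have h2 : MDifferentiableAt 𝓘(ℝ, Euc n) 𝓘(ℝ, ℝ) (inChart (n := n) ρ p)
      (chartAt (Euc n) p q) :=
    ((contDiff_inChart hρ p).differentiable (by simp) _).mdifferentiableAt
  have h3 : MDifferentiableAt (𝓡 n) 𝓘(ℝ, Euc n) (chartAt (Euc n) p) q :=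
    mdifferentiableAt_atlas (chart_mem_atlas _ p) hq
  have h4 := mfderiv_comp_apply (I := 𝓡 n) (I' := 𝓘(ℝ, Euc n)) (I'' := 𝓘(ℝ, ℝ)) q h2 h3 v
  rw [mfderiv_eq_fderiv] at h4
  refine Eq.trans ?_ h4
  rw [mvfderiv, ← h1.mfderiv_eq]
  rfl

theorem fieldInChart_eq (Y : (x : UnitSphere n) → TangentSpace (𝓡 n) x) (p : UnitSphere n)
    (y : Euc n) :
    fieldInChart Y p y = (trivializationAt (Euc n) (TangentSpace (𝓡 n)) p
      ⟨(chartAt (Euc n) p).symm y, Y ((chartAt (Euc n) p).symm y)⟩).2 := by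
  have hs : (chartAt (Euc n) p).symm y ∈ (chartAt (Euc n) p).source :=
    (chartAt (Euc n) p).map_target (by rw [chart_target]; trivial)
  rw [fieldInChart, mfderiv_chart_eq p _ hs]
  exact Trivialization.continuousLinearMapAt_apply_of_mem ℝ _ hs _

theorem fieldInChart_zero (Y : (x : UnitSphere n) → TangentSpace (𝓡 n) x) (p : UnitSphere n) :
    fieldInChart Y p 0 = Y p := by
  have h : fieldInChart Y p 0 = mfderiv (𝓡 n) (𝓡 n) (chartAt (Euc n) p) p (Y p) := by
    rw [fieldInChart, chart_symm_zero]
  have h2 : mfderiv (𝓡 n) (𝓡 n) (chartAt (Euc n) p) p = ContinuousLinearMap.id ℝ (Euc n) :=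
    mfderiv_extChartAt_self (I := 𝓡 n) (x := p)
  rw [h, h2]
  rfl

theorem contDiffAt_fieldInChart {Y : (x : UnitSphere n) → TangentSpace (𝓡 n) x}
    (hY : ContMDiffAt (𝓡 n) (𝓡 n).tangent ∞
      (fun z => (⟨z, Y z⟩ : TangentBundle (𝓡 n) (UnitSphere n))) p) :
    ContDiffAt ℝ ∞ (fieldInChart Y p) 0 := by
  have h1 := (contMDiffAt_section (F := Euc n) (E := TangentSpace (𝓡 n)) p).1 hY
  rw [← chart_symm_zero p] at h1
  have hsymm : ContMDiff 𝓘(ℝ, Euc n) (𝓡 n) ∞ (chartAt (Euc n) p).symm :=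
    (contMDiff_chart_symm p).of_le le_top
  have h2 := (h1.comp 0 hsymm.contMDiffAt).contDiffAt
  rw [chart_symm_zero] at h2
  exact h2.congr_of_eventuallyEq (Filter.Eventually.of_forall fun y => fieldInChart_eq Y p y)

/-- A function that vanishes on a regular level set has zero derivative along it. -/
theorem fderiv_eq_zero_of_eventually_zero {F : Type*} [NormedAddCommGroup F] [NormedSpace ℝ F]
    [CompleteSpace F] {f φ : F → ℝ} {x : F} (hf : ContDiffAt ℝ 1 f x) (hφ : ContDiffAt ℝ 1 φ x)
    (hf0 : f x = 0) (hd : fderiv ℝ f x ≠ 0) (h : ∀ᶠ y in 𝓝 x, f y = 0 → φ y = 0) {v : F}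
    (hv : fderiv ℝ f x v = 0) : fderiv ℝ φ x v = 0 := by
  -- `φ` vanishes on the level set, so `x` is trivially a constrained minimum, and Lagrange
  -- multipliers give `a df + b dφ = 0`. The coefficient `b` is nonzero because `df ≠ 0`.
  have hext : IsLocalExtrOn φ {y | f y = f x} x := by
    left
    rw [IsMinFilter]
    filter_upwards [mem_nhdsWithin_of_mem_nhds h, self_mem_nhdsWithin] with y h1 h2
    rw [h1 (h2.trans hf0), h.self_of_nhds hf0]
  obtain ⟨a, b, hab, h1⟩ := hext.exists_multipliers_of_hasStrictFDerivAt_1d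
    (hf.hasStrictFDerivAt (by simp)) (hφ.hasStrictFDerivAt (by simp))
  have hb : b ≠ 0 := by
    rintro rfl
    rw [zero_smul, add_zero] at h1
    rcases smul_eq_zero.1 h1 with h2 | h2
    · exact hab (by rw [h2]; rfl)
    · exact hd h2
  have h2 := DFunLike.congr_fun h1 v
  simp only [add_apply, smul_apply, hv, smul_zero, zero_add, zero_apply] at h2
  exact (smul_eq_zero.1 h2).resolve_left hb

end Boundary

/-! ### The normal, the second fundamental form and the boundary condition in terms of a defining
function -/

section Boundary

variable {Ω : Set (UnitSphere n)} {p : UnitSphere n} {ρ : UnitSphere n → ℝ}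

theorem inner_gradient (f : Euc n → ℝ) (y v : Euc n) :
    inner ℝ (gradient f y) v = fderiv ℝ f y v := by
  rw [← InnerProductSpace.toDual_apply_apply, toDual_gradient]

theorem IsDefiningFunction.fderiv_ne_zero (h : IsDefiningFunction n Ω p ρ) :
    fderiv ℝ (inChart (n := n) ρ p) 0 ≠ 0 := by
  obtain ⟨v, hv⟩ := h.exists_fderiv_neg
  intro h0
  rw [h0] at hv
  exact lt_irrefl _ hv

theorem IsDefiningFunction.gradient_ne_zero (h : IsDefiningFunction n Ω p ρ) :
    gradient (inChart (n := n) ρ p) 0 ≠ 0 := by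
  obtain ⟨v, hv⟩ := h.exists_fderiv_neg
  intro h0
  rw [← inner_gradient, h0, inner_zero_left] at hv
  exact lt_irrefl _ hv

/-- The gradient of the homogeneous extension of a defining function is tangent to the sphere. -/
theorem IsDefiningFunction.frame_gradient (h : IsDefiningFunction n Ω p ρ) :
    tangentFrame p (gradient (inChart (n := n) ρ p) 0) = gradient (homExt ρ) (p : Euc (n + 1)) := by
  refine ext_inner_right ℝ fun v => ?_
  obtain ⟨x, hv⟩ := exists_eq_smul_add_frame p v
  rw [inner_gradient, hv, inner_add_right, inner_smul_right, inner_frame_point, inner_frame,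
    inner_gradient, fderiv_inChart_zero h.1, map_add, map_smul, fderiv_homExt_self h.1, h.2.1]
  simp

/-- The component `r` of `ν` orthogonal to the gradient is tangent to the boundary, so `⟨ν, r⟩ = 0`
and hence `⟨r, r⟩ = 0`. The value of `c` is irrelevant to the boundary condition, both sides of
which are linear in `ν`. -/
theorem IsOutwardUnitNormal.exists_smul (h : IsDefiningFunction n Ω p ρ)
    {ν : TangentSpace (𝓡 n) p} (hν : IsOutwardUnitNormal (roundMetric n) Ω p ν) :
    ∃ c : ℝ, 0 < c ∧ (show Euc n from ν) = c • gradient (inChart (n := n) ρ p) 0 := by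
  set g := gradient (inChart (n := n) ρ p) 0 with hg
  have hg0 : g ≠ 0 := h.gradient_ne_zero
  have hgg : (0 : ℝ) < inner ℝ g g := real_inner_self_pos.2 hg0
  obtain ⟨x, hx⟩ : ∃ x : Euc n, x = ν := ⟨ν, rfl⟩
  have hpos : 0 < inner ℝ g x := by
    have := hν.outward ρ h
    rw [mvfderiv_eq_fderiv_inChart h.1] at this
    rw [hg, inner_gradient, hx]
    exact this
  refine ⟨inner ℝ g x / inner ℝ g g, div_pos hpos hgg, ?_⟩
  set r := x - (inner ℝ g x / inner ℝ g g) • g with hr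
  have h1 : inner ℝ g r = (0 : ℝ) := by
    rw [hr, inner_sub_right, inner_smul_right, div_mul_cancel₀ _ hgg.ne', sub_self]
  have h2 : inner ℝ x r = (0 : ℝ) := by
    have h3 : IsTangentToBoundary Ω p (show TangentSpace (𝓡 n) p from r) := by
      rw [h.isTangentToBoundary_iff, mvfderiv_eq_fderiv_inChart h.1]
      rw [inner_gradient] at h1
      exact h1
    have h4 := hν.normal _ h3
    rw [roundMetric_inner] at h4
    rw [hx]
    exact h4
  have h5 : inner ℝ r r = (0 : ℝ) := by
    conv_lhs => rw [hr]
    rw [inner_sub_left, inner_smul_left, h1, h2]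
    simp
  have h6 : r = 0 := inner_self_eq_zero.1 h5
  rw [hr, sub_eq_zero] at h6
  rw [← h6, hx]

/-- Without an actual normal the boundary condition, which quantifies over all normals, could hold
vacuously. -/
theorem IsDefiningFunction.isOutwardUnitNormal (h : IsDefiningFunction n Ω p ρ) :
    IsOutwardUnitNormal (roundMetric n) Ω p
      (show TangentSpace (𝓡 n) p from ‖gradient (inChart (n := n) ρ p) 0‖⁻¹ •
        gradient (inChart (n := n) ρ p) 0) := by
  set g := gradient (inChart (n := n) ρ p) 0 with hg
  have hg0 : ‖g‖ ≠ 0 := norm_ne_zero_iff.2 h.gradient_ne_zero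
  refine ⟨?_, fun v hv => ?_, fun ρ' h' => ?_⟩
  · rw [roundMetric_inner]
    change inner ℝ (‖g‖⁻¹ • g) (‖g‖⁻¹ • g) = (1 : ℝ)
    rw [inner_smul_left, inner_smul_right, real_inner_self_eq_norm_sq]
    simp only [conj_trivial]
    field_simp
  · rw [h.isTangentToBoundary_iff, mvfderiv_eq_fderiv_inChart h.1] at hv
    rw [roundMetric_inner]
    change inner ℝ (‖g‖⁻¹ • g) (show Euc n from v) = (0 : ℝ)
    rw [inner_smul_left, hg, inner_gradient, hv, mul_zero]
  · rw [mvfderiv_eq_fderiv_inChart h'.1]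
    refine h.fderiv_pos h' ?_
    change 0 < fderiv ℝ (inChart (n := n) ρ p) 0 (‖g‖⁻¹ • g)
    rw [map_smul, ← inner_gradient, ← hg, real_inner_self_eq_norm_sq, smul_eq_mul]
    positivity

theorem covDeriv_roundMetric (p : UnitSphere n) (v : Euc n)
    {Y : (x : UnitSphere n) → TangentSpace (𝓡 n) x}
    (hY : DifferentiableAt ℝ (fieldInChart Y p) 0) :
    covDeriv (roundMetric n) p v Y = fderiv ℝ (fieldInChart Y p) 0 v := by
  obtain ⟨D, hD⟩ : ∃ D, D = fderiv ℝ (fieldInChart Y p) 0 := ⟨_, rfl⟩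
  have hcomp : ∀ i k, partialDeriv i (fun y => fieldInChart Y p y k) 0 = D (basisVec i) k := by
    intro i k
    have h1 := ((EuclideanSpace.proj k : Euc n →L[ℝ] ℝ).hasFDerivAt).comp (0 : Euc n)
      hY.hasFDerivAt
    rw [partialDeriv]
    erw [h1.fderiv]
    rw [hD]
    rfl
  have h2 : ∀ k, (∑ i, v i * partialDeriv i (fun y => fieldInChart Y p y k)
      (chartAt (Euc n) p p)) + ∑ i, ∑ j, christoffel (metricCoord (roundMetric n) p) k i j
        (chartAt (Euc n) p p) * v i * vecComp (Y p) j = D v k := by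
    intro k
    rw [chart_self]
    simp only [hcomp, christoffel_roundMetric_zero, zero_mul, Finset.sum_const_zero, add_zero]
    conv_rhs => rw [← sum_smul_basisVec v]
    simp [map_sum]
  rw [← hD]
  exact congrArg (WithLp.toLp 2) (funext h2)

theorem IsTangentialFieldAt.fderiv_eq_zero (ho : IsOpen Ω) (h : IsDefiningFunction n Ω p ρ)
    {Y : (x : UnitSphere n) → TangentSpace (𝓡 n) x} (hY : IsTangentialFieldAt Ω p Y) :
    ∀ᶠ y in 𝓝 (0 : Euc n), inChart (n := n) ρ p y = 0 →
      fderiv ℝ (inChart (n := n) ρ p) y (fieldInChart Y p y) = 0 := by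
  have ht : Filter.Tendsto (chartAt (Euc n) p).symm (𝓝 0) (𝓝 p) := by
    have := (contMDiff_chart_symm p).continuous.tendsto 0
    rwa [chart_symm_zero] at this
  have h1 := eventually_nhdsWithin_iff.1 hY.2
  filter_upwards [ht.eventually h1, ht.eventually (h.eventually ho)] with y hy1 hy2 hy0
  have hs : (chartAt (Euc n) p).symm y ∈ (chartAt (Euc n) p).source :=
    (chartAt (Euc n) p).map_target (by rw [chart_target]; trivial)
  have h2 := hy1 (hy2.1.2 hy0) ρ (hy2.2 hy0)
  rw [mvfderiv_eq_fderiv_mfderiv h.1 p _ hs,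
    (chartAt (Euc n) p).right_inv (by rw [chart_target]; trivial)] at h2
  exact h2

theorem IsTangentialFieldAt.fderiv_apply_eq_zero (hp : p ∈ frontier Ω)
    (h : IsDefiningFunction n Ω p ρ)
    {Y : (x : UnitSphere n) → TangentSpace (𝓡 n) x} (hY : IsTangentialFieldAt Ω p Y) :
    fderiv ℝ (inChart (n := n) ρ p) 0 (show Euc n from Y p) = 0 := by
  rw [← mvfderiv_eq_fderiv_inChart h.1]
  exact hY.2.self_of_nhdsWithin hp ρ h

/-- The second fundamental form is the Hessian of a defining function, up to scaling. -/
theorem secondFundamentalForm_eq (ho : IsOpen Ω) (h : IsDefiningFunction n Ω p ρ)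
    {ν : TangentSpace (𝓡 n) p} {c : ℝ}
    (hν : (show Euc n from ν) = c • gradient (inChart (n := n) ρ p) 0)
    {X Y : (x : UnitSphere n) → TangentSpace (𝓡 n) x} (hX : IsTangentialFieldAt Ω p X)
    (hY : IsTangentialFieldAt Ω p Y) :
    secondFundamentalForm (roundMetric n) p ν X Y =
      c * fderiv ℝ (fderiv ℝ (homExt ρ)) p (tangentFrame p (show Euc n from X p))
        (tangentFrame p (show Euc n from Y p)) := by
  set f := inChart (n := n) ρ p with hf
  have hfs : ContDiff ℝ ∞ f := contDiff_inChart h.1 p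
  have hYs : ContDiffAt ℝ ∞ (fieldInChart Y p) 0 := contDiffAt_fieldInChart hY.1.self_of_nhds
  have hYd : DifferentiableAt ℝ (fieldInChart Y p) 0 := hYs.differentiableAt (by simp)
  have hdf : ContDiff ℝ ∞ (fderiv ℝ f) := hfs.fderiv_right (by simp)
  have hp := h.mem_frontier ho
  obtain ⟨v, hv⟩ : ∃ v : Euc n, v = X p := ⟨X p, rfl⟩
  obtain ⟨w, hw⟩ : ∃ w : Euc n, w = Y p := ⟨Y p, rfl⟩
  have hv0 : fderiv ℝ f 0 v = 0 := by rw [hv]; exact hX.fderiv_apply_eq_zero hp h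
  -- `df(Y)` vanishes on the boundary. Its derivative along the tangent vector `X` gives `D²f(X, Y)
  -- + df(D_X Y) = 0`.
  have h1 : fderiv ℝ (fun y => fderiv ℝ f y (fieldInChart Y p y)) 0 v = 0 := by
    refine fderiv_eq_zero_of_eventually_zero (hfs.of_le (by simp)).contDiffAt
      ((hdf.contDiffAt.clm_apply hYs).of_le (by simp)) ?_ h.fderiv_ne_zero
      (hY.fderiv_eq_zero ho h) hv0
    rw [hf, inChart, Function.comp_apply, chart_symm_zero, h.2.1]
  have hdfd := (hdf.differentiable (by simp) 0).hasFDerivAt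
  rw [(hdfd.clm_apply hYd.hasFDerivAt).fderiv, fieldInChart_zero] at h1
  have h2 : fderiv ℝ (fderiv ℝ f) 0 v w =
      fderiv ℝ (fderiv ℝ (homExt ρ)) p (tangentFrame p v) (tangentFrame p w) := by
    -- The correction between chart Hessian and ambient Hessian is a multiple of `ρ p = 0`.
    have h3 := fderiv_fderiv_inChart_zero h.1 p v w
    rw [h.2.1, zero_mul, sub_zero] at h3
    rw [← h3, (hdfd.clm_apply (hasFDerivAt_const w (0 : Euc n))).fderiv]
    simp
  have h4 : fderiv ℝ f 0 (fderiv ℝ (fieldInChart Y p) 0 v) + fderiv ℝ (fderiv ℝ f) 0 v w = 0 := by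
    rw [← hw] at h1
    simpa using h1
  have h5 : secondFundamentalForm (roundMetric n) p ν X Y =
      -(inner ℝ (c • gradient f 0) (fderiv ℝ (fieldInChart Y p) 0 v) : ℝ) := by
    rw [secondFundamentalForm, roundMetric_inner, hν, hv]
    congr 2
    exact covDeriv_roundMetric p _ hYd
  rw [h5, inner_smul_left, inner_gradient, ← hv, ← hw, ← h2]
  simp only [conj_trivial]
  linear_combination (-c) * h4

/-- Every vector tangent to the boundary extends to a tangential vector field. -/
theorem exists_isTangentialFieldAt (ho : IsOpen Ω) (h : IsDefiningFunction n Ω p ρ) {w : Euc n}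
    (hw : fderiv ℝ (inChart (n := n) ρ p) 0 w = 0) :
    ∃ Y : (x : UnitSphere n) → TangentSpace (𝓡 n) x, IsTangentialFieldAt Ω p Y ∧
      (show Euc n from Y p) = w := by
  set f := inChart (n := n) ρ p with hf
  have hfs : ContDiff ℝ ∞ f := contDiff_inChart h.1 p
  have hdf : ContDiff ℝ ∞ (fderiv ℝ f) := hfs.fderiv_right (by simp)
  obtain ⟨e, he⟩ := h.exists_fderiv_neg
  -- Projecting `w` along the transversal `e` onto the kernel of `df` at each point gives a field
  -- tangent to every nearby level set of `f`.
  set W : Euc n → Euc n := fun y => w - (fderiv ℝ f y w / fderiv ℝ f y e) • e with hW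
  have hcont : Continuous fun y => fderiv ℝ f y e := (hdf.clm_apply contDiff_const).continuous
  have hopen : IsOpen {y | fderiv ℝ f y e ≠ 0} := isOpen_ne.preimage hcont
  have hWs : ∀ y, fderiv ℝ f y e ≠ 0 → ContDiffAt ℝ ∞ W y := fun y hy =>
    contDiffAt_const.sub (((hdf.clm_apply contDiff_const).contDiffAt.div
      (hdf.clm_apply contDiff_const).contDiffAt hy).smul contDiffAt_const)
  have hWt : ∀ y, fderiv ℝ f y e ≠ 0 → fderiv ℝ f y (W y) = 0 := by
    intro y hy
    rw [hW, map_sub, map_smul, smul_eq_mul, div_mul_cancel₀ _ hy, sub_self]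
  have hW0 : W 0 = w := by simp [hW, hw]
  set t := trivializationAt (Euc n) (TangentSpace (𝓡 n)) p
  set φ := chartAt (Euc n) p
  set Y : (x : UnitSphere n) → TangentSpace (𝓡 n) x := fun x => t.symmL ℝ x (W (φ x)) with hYdef
  have hsrc : ∀ᶠ x in 𝓝 p, x ∈ φ.source := chart_source_mem_nhds (Euc n) p
  have hcl : ∀ x ∈ φ.source, t.continuousLinearMapAt ℝ x (Y x) = W (φ x) := fun x hx =>
    t.continuousLinearMapAt_symmL (R := ℝ) hx _
  have hev : ∀ᶠ x in 𝓝 p, fderiv ℝ f (φ x) e ≠ 0 := by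
    have : ContinuousAt φ p := φ.continuousAt (mem_chart_source _ p)
    refine this (hopen.mem_nhds ?_)
    change fderiv ℝ f (φ p) e ≠ 0
    rw [chart_self]
    exact he.ne
  refine ⟨Y, ⟨?_, ?_⟩, ?_⟩
  · filter_upwards [hsrc, hev] with x hx hx2
    refine (t.contMDiffAt_section_iff (IB := 𝓡 n) (n := ∞) hx).2 ?_
    have h1 : ContMDiffAt (𝓡 n) 𝓘(ℝ, Euc n) ∞ φ x :=
      (contMDiffOn_chart (I := 𝓡 n) (n := ∞) (x := p)).contMDiffAt (φ.open_source.mem_nhds hx)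
    refine ((hWs _ hx2).contMDiffAt.comp x h1).congr_of_eventuallyEq ?_
    filter_upwards [φ.open_source.mem_nhds hx] with z hz
    rw [← t.continuousLinearMapAt_apply_of_mem ℝ hz]
    exact hcl z hz
  · filter_upwards [mem_nhdsWithin_of_mem_nhds hsrc, mem_nhdsWithin_of_mem_nhds hev,
      mem_nhdsWithin_of_mem_nhds (h.eventually ho), self_mem_nhdsWithin] with x hx hx2 hx3 hx4
    rw [(hx3.2 (hx3.1.1 hx4)).isTangentToBoundary_iff, mvfderiv_eq_fderiv_mfderiv h.1 p x hx,
      mfderiv_chart_eq p x hx, hcl x hx]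
    exact hWt _ hx2
  · have hp : p ∈ φ.source := mem_chart_source _ p
    have h1 : (show Euc n from Y p) = mfderiv (𝓡 n) (𝓡 n) φ p (Y p) := by
      have h2 : mfderiv (𝓡 n) (𝓡 n) φ p = ContinuousLinearMap.id ℝ (Euc n) :=
        mfderiv_extChartAt_self (I := 𝓡 n) (x := p)
      rw [h2]
      rfl
    rw [h1, mfderiv_chart_eq p p hp, hcl p hp, chart_self, hW0]

/-- The boundary condition at a boundary point, in terms of homogeneous extensions. -/
theorem boundaryCondition_at_iff (ho : IsOpen Ω) (h : IsDefiningFunction n Ω p ρ)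
    {U : UnitSphere n → ℝ} (hU : ContMDiff (𝓡 n) 𝓘(ℝ, ℝ) ∞ U) :
    (∀ ν : TangentSpace (𝓡 n) p, IsOutwardUnitNormal (roundMetric n) Ω p ν →
      ∀ X Y : (x : UnitSphere n) → TangentSpace (𝓡 n) x,
        IsTangentialFieldAt Ω p X → IsTangentialFieldAt Ω p Y →
          mvfderiv (𝓡 n) U p ν * (roundMetric n).inner p (X p) (Y p) =
            U p * secondFundamentalForm (roundMetric n) p ν X Y) ↔
    ∀ v w : Euc (n + 1), inner ℝ (p : Euc (n + 1)) v = (0 : ℝ) →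
      inner ℝ (p : Euc (n + 1)) w = (0 : ℝ) → fderiv ℝ (homExt ρ) p v = 0 →
      fderiv ℝ (homExt ρ) p w = 0 →
      fderiv ℝ (homExt U) p (gradient (homExt ρ) (p : Euc (n + 1))) * inner ℝ v w =
        U p * fderiv ℝ (fderiv ℝ (homExt ρ)) p v w := by
  have hg0 := h.gradient_ne_zero
  rw [← h.frame_gradient]
  set g := gradient (inChart (n := n) ρ p) 0 with hg
  have hUν : ∀ (ν : TangentSpace (𝓡 n) p) (c : ℝ), (show Euc n from ν) = c • g →
      mvfderiv (𝓡 n) U p ν = c * fderiv ℝ (homExt U) p (tangentFrame p g) := by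
    intro ν c hc
    rw [mvfderiv_eq_fderiv_homExt hU, hc, map_smul, map_smul, smul_eq_mul]
  constructor
  · intro hb v w hpv hpw hv hw
    obtain ⟨v, rfl⟩ := exists_frame_eq p hpv
    obtain ⟨w, rfl⟩ := exists_frame_eq p hpw
    rw [← fderiv_inChart_zero h.1] at hv hw
    obtain ⟨X, hX, hXv⟩ := exists_isTangentialFieldAt ho h hv
    obtain ⟨Y, hY, hYw⟩ := exists_isTangentialFieldAt ho h hw
    have hc : (0 : ℝ) < ‖g‖⁻¹ := inv_pos.2 (norm_pos_iff.2 hg0)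
    have h1 := hb _ h.isOutwardUnitNormal X Y hX hY
    rw [hUν _ ‖g‖⁻¹ rfl, secondFundamentalForm_eq ho h (c := ‖g‖⁻¹) rfl hX hY, roundMetric_inner,
      hXv, hYw] at h1
    rw [inner_frame]
    refine mul_left_cancel₀ hc.ne' ?_
    linear_combination h1
  · intro hb ν hν X Y hX hY
    obtain ⟨c, hc, hνc⟩ := hν.exists_smul h
    have hp := h.mem_frontier ho
    have hX0 := hX.fderiv_apply_eq_zero hp h
    have hY0 := hY.fderiv_apply_eq_zero hp h
    rw [fderiv_inChart_zero h.1] at hX0 hY0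
    have h1 := hb _ _ (inner_point_frame p _) (inner_point_frame p _) hX0 hY0
    rw [inner_frame] at h1
    rw [hUν _ c hνc, secondFundamentalForm_eq ho h hνc hX hY, roundMetric_inner]
    linear_combination c * h1

end Boundary

/-! ### The space of static potentials -/

theorem exists_inner_of_mem_kerPhiStar (hn : 2 ≤ n) {Ω : Set (UnitSphere n)}
    (hΩ : IsSmoothDomain n Ω) {u : closure Ω → ℝ} (hu : u ∈ kerPhiStar (roundMetric n) Ω) :
    ∃ a : Euc (n + 1), (∀ x : closure Ω, u x = inner ℝ a (x.1 : Euc (n + 1))) ∧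
      ∀ p ∈ frontier Ω, ∀ ρ : UnitSphere n → ℝ, IsDefiningFunction n Ω p ρ →
        ∀ v w : Euc (n + 1), inner ℝ (p : Euc (n + 1)) v = (0 : ℝ) →
          inner ℝ (p : Euc (n + 1)) w = (0 : ℝ) → fderiv ℝ (homExt ρ) p v = 0 →
          fderiv ℝ (homExt ρ) p w = 0 →
          inner ℝ a (gradient (homExt ρ) (p : Euc (n + 1))) * inner ℝ v w =
            inner ℝ a (p : Euc (n + 1)) * fderiv ℝ (fderiv ℝ (homExt ρ)) p v w := by
  obtain ⟨U, hU, hUu, hL, hB⟩ := hu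
  obtain ⟨a, ha⟩ := exists_fderiv_homExt_eq hn hU hΩ.isOpen hΩ.isConnected.isPreconnected hL
  refine ⟨a, fun x => ?_, fun p hp ρ hρ v w hpv hpw hv hw => ?_⟩
  · rw [← hUu, eq_inner_of_fderiv_homExt_eq hU (ha x x.2)]
  · have hpc := frontier_subset_closure hp
    have h := (boundaryCondition_at_iff hΩ.isOpen hρ hU).1 (hB p hp) v w hpv hpw hv hw
    rw [ha p hpc, eq_inner_of_fderiv_homExt_eq hU (ha p hpc)] at h
    exact h

/-- Two linear conditions on a space of dimension `n + 1 ≥ 3`. With `a` a boundary point and `b` its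
normal it produces a nonzero tangent vector of the boundary. -/
theorem exists_ne_zero_orthogonal (hn : 2 ≤ n) (a b : Euc (n + 1)) :
    ∃ v : Euc (n + 1), v ≠ 0 ∧ inner ℝ a v = (0 : ℝ) ∧ inner ℝ b v = (0 : ℝ) := by
  set f : Euc (n + 1) →ₗ[ℝ] ℝ × ℝ := (innerₛₗ ℝ a).prod (innerₛₗ ℝ b)
  have h : LinearMap.ker f ≠ ⊥ := LinearMap.ker_ne_bot_of_finrank_lt (by
    rw [Module.finrank_prod, Module.finrank_self, finrank_euclideanSpace_fin]
    omega)
  obtain ⟨v, hv, hv0⟩ := Submodule.exists_mem_ne_zero_of_ne_bot h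
  have := LinearMap.mem_ker.1 hv
  exact ⟨v, hv0, congrArg Prod.fst this, congrArg Prod.snd this⟩

/-! ### Spherical caps -/

theorem mem_sphericalCap_iff {N : UnitSphere n} {θ : ℝ} (h0 : 0 < θ) (hπ : θ < Real.pi)
    (x : UnitSphere n) :
    x ∈ sphericalCap N θ ↔ Real.cos θ < inner ℝ (N : Euc (n + 1)) (x : Euc (n + 1)) := by
  have h1 : Real.cos (InnerProductGeometry.angle (N : Euc (n + 1)) (x : Euc (n + 1))) =
      inner ℝ (N : Euc (n + 1)) (x : Euc (n + 1)) := by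
    rw [InnerProductGeometry.cos_angle, norm_unitSphere, norm_unitSphere]
    simp
  rw [← h1]
  exact (Real.strictAntiOn_cos.lt_iff_gt ⟨h0.le, hπ.le⟩
    ⟨InnerProductGeometry.angle_nonneg _ _, InnerProductGeometry.angle_le_pi _ _⟩).symm

theorem inner_stereoMap (N : UnitSphere n) (y : Euc n) :
    inner ℝ (N : Euc (n + 1)) (stereoMap N y) = 8 * stereoFactor y - 1 := by
  rw [stereoMap, inner_sub_right, inner_smul_right, inner_add_right, inner_smul_right,
    inner_smul_right, inner_point_frame, inner_self_unitSphere]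
  ring

/-- A defining function of the cap `{c < ⟨N, x⟩}`. -/
def capFun (N : UnitSphere n) (c : ℝ) (x : UnitSphere n) : ℝ :=
  c - inner ℝ (N : Euc (n + 1)) (x : Euc (n + 1))

section Cap

variable (N : UnitSphere n) (c : ℝ)

theorem contMDiff_capFun : ContMDiff (𝓡 n) 𝓘(ℝ, ℝ) ∞ (capFun N c) :=
  contMDiff_const.sub (contMDiff_linear (N : Euc (n + 1)))

theorem inChart_capFun (p : UnitSphere n) :
    inChart (n := n) (capFun N c) p = fun y => c - innerSL ℝ (N : Euc (n + 1)) (stereoMap p y) := by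
  funext y
  rw [inChart, Function.comp_apply, capFun, coe_chart_symm]
  rfl

theorem fderiv_inChart_capFun (p : UnitSphere n) (y v : Euc n) :
    fderiv ℝ (inChart (n := n) (capFun N c) p) y v =
      -(innerSL ℝ (N : Euc (n + 1)) (fderiv ℝ (stereoMap p) y v)) := by
  rw [inChart_capFun]
  have h := ((innerSL ℝ (N : Euc (n + 1))).hasFDerivAt.comp y
    (hasFDerivAt_stereoMap p y).differentiableAt.hasFDerivAt).const_sub c
  erw [h.fderiv]
  rfl

theorem fderiv_homExt_capFun_frame (p : UnitSphere n) (v : Euc n) :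
    fderiv ℝ (homExt (capFun N c)) p (tangentFrame p v) =
      -inner ℝ (N : Euc (n + 1)) (tangentFrame p v) := by
  rw [← fderiv_inChart_zero (contMDiff_capFun N c), fderiv_inChart_capFun, fderiv_stereoMap_zero]
  rfl

/-- The extension is `c ‖z‖ - ⟨N, z⟩` away from the origin: the linear part has no Hessian and
`D²‖z‖` is the metric on `p^⊥`. The derivation goes through the chart, where the two multiples of
`⟨N, p⟩` cancel. -/
theorem hessian_homExt_capFun (p : UnitSphere n) (v w : Euc n) :
    fderiv ℝ (fderiv ℝ (homExt (capFun N c))) p (tangentFrame p v) (tangentFrame p w) =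
      c * inner ℝ v w := by
  have h1 := fderiv_fderiv_inChart_zero (contMDiff_capFun N c) p v w
  have h2 : (fun y => fderiv ℝ (inChart (n := n) (capFun N c) p) y w) = fun y =>
      -(innerSL ℝ (N : Euc (n + 1)) (fderiv ℝ (stereoMap p) y w)) :=
    funext fun y => fderiv_inChart_capFun N c p y w
  have h3 := ((innerSL ℝ (N : Euc (n + 1))).hasFDerivAt.comp (0 : Euc n)
    (hasFDerivAt_fderiv_stereoMap_zero p w)).neg
  rw [h2] at h1
  erw [h3.fderiv] at h1
  simp only [neg_apply, ContinuousLinearMap.comp_apply, ContinuousLinearMap.smulRight_apply,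
    map_smul, innerSL_apply_apply, smul_eq_mul, capFun, real_inner_comm v w] at h1
  linear_combination -h1

variable {N c}

theorem gradient_homExt_capFun {p : UnitSphere n} (hp : capFun N c p = 0) :
    gradient (homExt (capFun N c)) (p : Euc (n + 1)) = c • (p : Euc (n + 1)) - N := by
  refine ext_inner_right ℝ fun v => ?_
  obtain ⟨x, hv⟩ := exists_eq_smul_add_frame p v
  rw [inner_gradient, hv, map_add, map_smul, fderiv_homExt_self (contMDiff_capFun N c), hp,
    fderiv_homExt_capFun_frame, inner_add_right, inner_sub_left, inner_smul_left,
    inner_smul_right, inner_sub_left, inner_smul_left, inner_self_unitSphere, inner_smul_right,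
    inner_point_frame]
  simp only [capFun] at hp
  simp only [conj_trivial, smul_eq_mul]
  linear_combination (-(inner ℝ (p : Euc (n + 1)) v : ℝ)) * hp

/-- A critical zero `p` of `capFun N c` would give `N = c • p`, which is impossible for unit vectors
when `|c| < 1`. -/
theorem isDefiningFunction_capFun (hc : |c| < 1) {Ω : Set (UnitSphere n)}
    (hΩ : ∀ x, x ∈ Ω ↔ capFun N c x < 0) {p : UnitSphere n} (hp : capFun N c p = 0) :
    IsDefiningFunction n Ω p (capFun N c) := by
  refine ⟨contMDiff_capFun N c, hp, fun h => ?_, Filter.Eventually.of_forall hΩ⟩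
  have h1 : ∀ v : Euc n, inner ℝ (N : Euc (n + 1)) (tangentFrame p v) = (0 : ℝ) := fun v => by
    have h2 := mvfderiv_eq_fderiv_homExt (contMDiff_capFun N c) p v
    rw [h] at h2
    have h3 := h2.symm.trans (rfl : _ = (0 : ℝ))
    rw [fderiv_homExt_capFun_frame] at h3
    exact neg_eq_zero.1 h3
  have h2 : gradient (homExt (capFun N c)) (p : Euc (n + 1)) = 0 := by
    refine ext_inner_right ℝ fun v => ?_
    obtain ⟨x, hv⟩ := exists_eq_smul_add_frame p v
    rw [inner_gradient, hv, map_add, map_smul, fderiv_homExt_self (contMDiff_capFun N c), hp,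
      fderiv_homExt_capFun_frame, h1]
    simp
  rw [gradient_homExt_capFun hp, sub_eq_zero] at h2
  have h3 := norm_unitSphere N
  rw [← h2, norm_smul, norm_unitSphere, mul_one, Real.norm_eq_abs] at h3
  linarith

end Cap

section SphericalCap

variable {N : UnitSphere n} {θ : ℝ}

theorem abs_cos_lt_one (h0 : 0 < θ) (hπ : θ < Real.pi) : |Real.cos θ| < 1 := by
  have h1 := Real.sin_pos_of_pos_of_lt_pi h0 hπ
  rw [← sq_lt_one_iff_abs_lt_one]
  nlinarith [Real.sin_sq_add_cos_sq θ]

theorem mem_sphericalCap_iff_capFun (h0 : 0 < θ) (hπ : θ < Real.pi) (x : UnitSphere n) :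
    x ∈ sphericalCap N θ ↔ capFun N (Real.cos θ) x < 0 := by
  rw [mem_sphericalCap_iff h0 hπ, capFun, sub_neg]

theorem isOpen_sphericalCap (h0 : 0 < θ) (hπ : θ < Real.pi) : IsOpen (sphericalCap N θ) := by
  have h : sphericalCap N θ = {x | capFun N (Real.cos θ) x < 0} :=
    Set.ext (mem_sphericalCap_iff_capFun h0 hπ)
  rw [h]
  exact isOpen_lt (contMDiff_capFun N _).continuous continuous_const

theorem mem_frontier_sphericalCap_iff (h0 : 0 < θ) (hπ : θ < Real.pi) (x : UnitSphere n) :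
    x ∈ frontier (sphericalCap N θ) ↔ capFun N (Real.cos θ) x = 0 :=
  ⟨eq_zero_of_mem_frontier (isOpen_sphericalCap h0 hπ) (contMDiff_capFun N _).continuous
    (Filter.Eventually.of_forall (mem_sphericalCap_iff_capFun h0 hπ)),
  fun h => (isDefiningFunction_capFun (abs_cos_lt_one h0 hπ)
    (mem_sphericalCap_iff_capFun h0 hπ) h).mem_frontier (isOpen_sphericalCap h0 hπ)⟩

theorem exists_eq_chart_symm {x : UnitSphere n} (hx : x ≠ -N) :
    ∃ y : Euc n, (chartAt (Euc n) N).symm y = x :=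
  ⟨chartAt (Euc n) N x, (chartAt (Euc n) N).left_inv (by rw [chart_source]; exact hx)⟩

theorem capFun_neg (c : ℝ) : capFun N c (-N) = c + 1 := by
  have h : ((-N : UnitSphere n) : Euc (n + 1)) = -(N : Euc (n + 1)) := rfl
  rw [capFun, h, inner_neg_right, inner_self_unitSphere]
  ring

/-- The radius of the image of the cap `{c < ⟨N, x⟩}` in the stereographic chart at `N`. -/
def capRadius (c : ℝ) : ℝ := √(8 / (1 + c) - 4)

theorem capRadius_sq {c : ℝ} (hc : |c| < 1) : capRadius c ^ 2 = 8 / (1 + c) - 4 ∧ 0 < capRadius c := by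
  obtain ⟨h1, h2⟩ := abs_lt.1 hc
  have h3 : 0 < 8 / (1 + c) - 4 := by
    rw [sub_pos, lt_div_iff₀ (by linarith)]
    linarith
  exact ⟨Real.sq_sqrt h3.le, Real.sqrt_pos.2 h3⟩

/-- In the chart at `N` one has `⟨N, x⟩ = 8 * stereoFactor y - 1`; factoring out `stereoFactor y`
with `1 = stereoFactor y * (‖y‖² + 4)` is what determines `capRadius`. -/
theorem capFun_chart_symm {c : ℝ} (hc : |c| < 1) (y : Euc n) :
    capFun N c ((chartAt (Euc n) N).symm y) =
      (1 + c) * stereoFactor y * (‖y‖ ^ 2 - capRadius c ^ 2) := by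
  obtain ⟨h1, h2⟩ := abs_lt.1 hc
  have h3 : (1 + c) * (8 / (1 + c)) = 8 := mul_div_cancel₀ _ (by linarith)
  rw [capFun, coe_chart_symm, inner_stereoMap, (capRadius_sq hc).1]
  linear_combination (-(1 + c)) * stereoFactor_mul y + stereoFactor y * h3

theorem capFun_chart_symm_neg_iff {c : ℝ} (hc : |c| < 1) (y : Euc n) :
    capFun N c ((chartAt (Euc n) N).symm y) < 0 ↔ ‖y‖ < capRadius c := by
  have h1 : 0 < (1 + c) * stereoFactor y :=
    mul_pos (by linarith [(abs_lt.1 hc).1]) (stereoFactor_pos y)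
  rw [capFun_chart_symm hc, mul_neg_iff, ← sq_lt_sq₀ (norm_nonneg y) (capRadius_sq hc).2.le]
  constructor
  · rintro (⟨_, h⟩ | ⟨h, _⟩) <;> linarith
  · intro h
    exact Or.inl ⟨h1, by linarith⟩

theorem capFun_chart_symm_eq_zero_iff {c : ℝ} (hc : |c| < 1) (y : Euc n) :
    capFun N c ((chartAt (Euc n) N).symm y) = 0 ↔ ‖y‖ = capRadius c := by
  have h1 : 0 < (1 + c) * stereoFactor y :=
    mul_pos (by linarith [(abs_lt.1 hc).1]) (stereoFactor_pos y)
  rw [capFun_chart_symm hc, mul_eq_zero, ← sq_eq_sq₀ (norm_nonneg y) (capRadius_sq hc).2.le]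
  constructor
  · rintro (h | h) <;> linarith
  · intro h
    exact Or.inr (by linarith)

/-- This and the next lemma reduce connectedness of the cap and of its boundary to balls and spheres
of `ℝⁿ`. The antipode `-N` missed by the chart does no harm, as `capFun` equals `c + 1 > 0` there.
-/
theorem sphericalCap_eq_image (h0 : 0 < θ) (hπ : θ < Real.pi) : sphericalCap N θ =
    (chartAt (Euc n) N).symm '' Metric.ball 0 (capRadius (Real.cos θ)) := by
  have hc := abs_cos_lt_one h0 hπ
  ext x
  rw [mem_sphericalCap_iff_capFun h0 hπ]
  constructor
  · intro hx
    obtain ⟨y, rfl⟩ := exists_eq_chart_symm (N := N) (x := x) (by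
      rintro rfl
      rw [capFun_neg] at hx
      linarith [(abs_lt.1 hc).1])
    exact ⟨y, mem_ball_zero_iff.2 ((capFun_chart_symm_neg_iff hc y).1 hx), rfl⟩
  · rintro ⟨y, hy, rfl⟩
    exact (capFun_chart_symm_neg_iff hc y).2 (mem_ball_zero_iff.1 hy)

theorem frontier_sphericalCap_eq_image (h0 : 0 < θ) (hπ : θ < Real.pi) :
    frontier (sphericalCap N θ) =
      (chartAt (Euc n) N).symm '' Metric.sphere 0 (capRadius (Real.cos θ)) := by
  have hc := abs_cos_lt_one h0 hπ
  ext x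
  rw [mem_frontier_sphericalCap_iff h0 hπ]
  constructor
  · intro hx
    obtain ⟨y, rfl⟩ := exists_eq_chart_symm (N := N) (x := x) (by
      rintro rfl
      rw [capFun_neg] at hx
      linarith [(abs_lt.1 hc).1])
    exact ⟨y, mem_sphere_zero_iff_norm.2 ((capFun_chart_symm_eq_zero_iff hc y).1 hx), rfl⟩
  · rintro ⟨y, hy, rfl⟩
    exact (capFun_chart_symm_eq_zero_iff hc y).2 (mem_sphere_zero_iff_norm.1 hy)

theorem isConnected_frontier_sphericalCap (hn : 2 ≤ n) (h0 : 0 < θ) (hπ : θ < Real.pi) :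
    IsConnected (frontier (sphericalCap N θ)) := by
  rw [frontier_sphericalCap_eq_image h0 hπ]
  refine (isConnected_sphere ?_ _ (capRadius_sq (abs_cos_lt_one h0 hπ)).2.le).image _
    (contMDiff_chart_symm N).continuous.continuousOn
  rw [← Module.finrank_eq_rank, finrank_euclideanSpace_fin]
  exact_mod_cast hn

theorem isSmoothDomain_sphericalCap (h0 : 0 < θ) (hπ : θ < Real.pi) :
    IsSmoothDomain n (sphericalCap N θ) where
  isOpen := isOpen_sphericalCap h0 hπ
  isConnected := by
    rw [sphericalCap_eq_image h0 hπ]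
    exact ((convex_ball _ _).isConnected (Metric.nonempty_ball.2
      (capRadius_sq (abs_cos_lt_one h0 hπ)).2)).image _
      (contMDiff_chart_symm N).continuous.continuousOn
  smooth_boundary p hp := ⟨_, isDefiningFunction_capFun (abs_cos_lt_one h0 hπ)
    (mem_sphericalCap_iff_capFun h0 hπ) ((mem_frontier_sphericalCap_iff h0 hπ p).1 hp)⟩

/-- The static potentials on a cap centred at `N` are the linear functions `⟨a, x⟩`, `a ⊥ N`. -/
theorem mem_kerPhiStar_sphericalCap_iff (hn : 2 ≤ n) (h0 : 0 < θ) (hπ : θ < Real.pi)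
    (u : closure (sphericalCap N θ) → ℝ) :
    u ∈ kerPhiStar (roundMetric n) (sphericalCap N θ) ↔ ∃ a : Euc (n + 1),
      (∀ x : closure (sphericalCap N θ), u x = inner ℝ a (x.1 : Euc (n + 1))) ∧
      inner ℝ a (N : Euc (n + 1)) = (0 : ℝ) := by
  have hdom := isSmoothDomain_sphericalCap (N := N) h0 hπ
  set c := Real.cos θ with hcdef
  have hdef : ∀ p ∈ frontier (sphericalCap N θ), capFun N c p = 0 ∧
      IsDefiningFunction n (sphericalCap N θ) p (capFun N c) := fun p hp =>
    have h := (mem_frontier_sphericalCap_iff h0 hπ p).1 hp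
    ⟨h, isDefiningFunction_capFun (abs_cos_lt_one h0 hπ) (mem_sphericalCap_iff_capFun h0 hπ) h⟩
  constructor
  · intro hker
    obtain ⟨a, hu, hB⟩ := exists_inner_of_mem_kerPhiStar hn hdom hker
    refine ⟨a, hu, ?_⟩
    obtain ⟨p, hp⟩ := (isConnected_frontier_sphericalCap (N := N) hn h0 hπ).nonempty
    obtain ⟨hp0, hρ⟩ := hdef p hp
    -- For a nonzero `v` tangent to the boundary the condition is `⟨a, c p - N⟩⟨v, v⟩ = c ⟨a, p⟩⟨v,
    -- v⟩`, so `⟨a, N⟩ = 0`.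
    obtain ⟨v, hv, hpv, hNv⟩ := exists_ne_zero_orthogonal hn (p : Euc (n + 1)) (N : Euc (n + 1))
    obtain ⟨v, rfl⟩ := exists_frame_eq p hpv
    have hv0 : fderiv ℝ (homExt (capFun N c)) p (tangentFrame p v) = 0 := by
      rw [fderiv_homExt_capFun_frame, hNv, neg_zero]
    have h := hB p hp _ hρ _ _ hpv hpv hv0 hv0
    rw [hessian_homExt_capFun, gradient_homExt_capFun hp0, inner_frame, inner_sub_right,
      inner_smul_right] at h
    have hvv : (inner ℝ v v : ℝ) ≠ 0 := by
      rw [← inner_frame p]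
      exact (real_inner_self_pos.2 hv).ne'
    refine (mul_eq_zero.1 (?_ : inner ℝ a (N : Euc (n + 1)) * inner ℝ v v = (0 : ℝ))).resolve_right
      hvv
    linear_combination -h
  · rintro ⟨a, hu, haN⟩
    refine ⟨fun x => inner ℝ a (x : Euc (n + 1)), contMDiff_linear a, fun x => (hu x).symm, ?_, ?_⟩
    · intro p _
      rw [forall_LStar_eq_zero_iff hn (contMDiff_linear a)]
      rw [homExt_linear, show fderiv ℝ (innerSL ℝ a : Euc (n + 1) → ℝ) = fun _ => innerSL ℝ a from
        funext fun z => ContinuousLinearMap.fderiv _]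
      simp
    · intro p hp
      obtain ⟨hp0, hρ⟩ := hdef p hp
      refine (boundaryCondition_at_iff hdom.isOpen hρ (contMDiff_linear a)).2 ?_
      intro v w hpv hpw _ _
      obtain ⟨v, rfl⟩ := exists_frame_eq p hpv
      obtain ⟨w, rfl⟩ := exists_frame_eq p hpw
      rw [fderiv_homExt_linear, hessian_homExt_capFun, gradient_homExt_capFun hp0, inner_frame,
        innerSL_apply_apply, inner_sub_right, inner_smul_right, haN]
      ring

theorem isNonGenericDomain_sphericalCap (hn : 2 ≤ n) (h0 : 0 < θ) (hπ : θ < Real.pi) :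
    IsNonGenericDomain (roundMetric n) (sphericalCap N θ) := by
  refine ⟨isSmoothDomain_sphericalCap h0 hπ, ?_⟩
  -- Any nonzero `a ⊥ N` serves; the second vector `0` imposes no condition.
  obtain ⟨a, ha, haN, -⟩ := exists_ne_zero_orthogonal hn (N : Euc (n + 1)) 0
  refine ⟨fun x => inner ℝ a (x.1 : Euc (n + 1)), (mem_kerPhiStar_sphericalCap_iff hn h0 hπ _).2
    ⟨a, fun x => rfl, by rw [real_inner_comm, haN]⟩, fun hzero => ?_⟩
  obtain ⟨v, rfl⟩ := exists_frame_eq N haN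
  have hv : v ≠ 0 := fun h => ha (by rw [h, map_zero])
  have hr := (capRadius_sq (abs_cos_lt_one h0 hπ)).2
  -- The chart point `t • v` lies in direction `a` at half the radius of the cap, where `⟨a, x⟩` is
  -- a positive multiple of `⟨v, v⟩`.
  set t := capRadius (Real.cos θ) / 2 / ‖v‖ with ht
  have htpos : 0 < t := div_pos (half_pos hr) (norm_pos_iff.2 hv)
  have hmem : (chartAt (Euc n) N).symm (t • v) ∈ sphericalCap N θ := by
    rw [sphericalCap_eq_image h0 hπ]
    refine ⟨t • v, mem_ball_zero_iff.2 ?_, rfl⟩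
    rw [norm_smul, Real.norm_of_nonneg htpos.le, ht, div_mul_cancel₀ _ (norm_ne_zero_iff.2 hv)]
    linarith
  have h1 := congrFun hzero ⟨_, subset_closure hmem⟩
  simp only [coe_chart_symm, Pi.zero_apply, stereoMap, inner_sub_right, inner_smul_right,
    inner_add_right, inner_frame_point, inner_frame, mul_zero, add_zero, sub_zero] at h1
  have h2 : (0 : ℝ) < inner ℝ v v := real_inner_self_pos.2 hv
  have h3 := stereoFactor_pos (t • v)
  have : 0 < stereoFactor (t • v) * (4 * (t * inner ℝ v v)) := by positivity
  exact this.ne' h1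

theorem kerPhiStar_sphericalCap_northPole (hn : 2 ≤ n) (h0 : 0 < θ) (hπ : θ < Real.pi) :
    kerPhiStar (roundMetric n) (sphericalCap (northPole n) θ) =
      (Submodule.span ℝ (Set.range fun i : Fin n =>
        coordFun (closure (sphericalCap (northPole n) θ)) i.castSucc) :
        Set (closure (sphericalCap (northPole n) θ) → ℝ)) := by
  ext u
  rw [mem_kerPhiStar_sphericalCap_iff hn h0 hπ, SetLike.mem_coe,
    Submodule.mem_span_range_iff_exists_fun]
  constructor
  · rintro ⟨a, hu, ha⟩
    have ha' : a (Fin.last n) = 0 := by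
      simpa [northPole, EuclideanSpace.inner_single_right] using ha
    refine ⟨fun i => a i.castSucc, funext fun x => ?_⟩
    rw [hu, PiLp.inner_apply, Fin.sum_univ_castSucc, ha']
    simp [coordFun, mul_comm]
  · rintro ⟨b, rfl⟩
    refine ⟨WithLp.toLp 2 (Fin.snoc b 0), fun x => ?_, ?_⟩
    · rw [PiLp.inner_apply, Fin.sum_univ_castSucc]
      simp [coordFun, mul_comm]
    · simp [northPole, EuclideanSpace.inner_single_right]

end SphericalCap

/-! ### Local rigidity of the boundary -/

section LocalRigidity

variable {H F : Type*} [NormedAddCommGroup H] [NormedSpace ℝ H] [NormedAddCommGroup F]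

/-- The derivative is continuous, so vanishing on a set dense near `x₀` makes it vanish on a ball.
This is how the zeros of `⟨a, x⟩` are crossed. -/
theorem eventually_eq_of_fderiv_eq_zero_of_dense [NormedSpace ℝ F] {φ : H → F} {x₀ : H} {S : Set H}
    (h1 : ∀ᶠ s in 𝓝 x₀, ContDiffAt ℝ 1 φ s) (h2 : ∀ᶠ s in 𝓝 x₀, s ∈ closure S)
    (h3 : ∀ᶠ s in 𝓝 x₀, s ∈ S → fderiv ℝ φ s = 0) : ∀ᶠ s in 𝓝 x₀, φ s = φ x₀ := by
  have h4 : ∀ᶠ s in 𝓝 x₀, fderiv ℝ φ s = 0 := by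
    filter_upwards [h1, h2, h3.eventually_nhds] with s hs1 hs2 hs3
    have h5 : fderiv ℝ φ s ∈ ({0} : Set (H →L[ℝ] F)) :=
      isClosed_singleton.mem_of_frequently_of_tendsto
        (((mem_closure_iff_frequently.1 hs2).and_eventually hs3).mono fun t ht => ht.2 ht.1)
        (hs1.continuousAt_fderiv one_ne_zero)
    exact h5
  obtain ⟨r, hr, hball⟩ := Metric.eventually_nhds_iff_ball.1 (h1.and h4)
  filter_upwards [Metric.ball_mem_nhds x₀ hr] with s hs
  refine (convex_ball x₀ r).is_const_of_fderivWithin_eq_zero (𝕜 := ℝ)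
    (fun y hy => ((hball y hy).1.differentiableAt one_ne_zero).differentiableWithinAt)
    (fun y hy => ?_) hs (Metric.mem_ball_self hr)
  rw [fderivWithin_of_isOpen Metric.isOpen_ball hy, (hball y hy).2]

variable [InnerProductSpace ℝ F]

/-- Pairing `hA` with `a` is precisely the vanishing of the numerator in the quotient rule for `⟨a,
ν⟩ / ⟨a, x⟩`, so its `C¹` extension `l` is constant. Cancelling `⟨a, x⟩` in `hA` then gives `dν = l
dx`. -/
theorem eventually_eq_smul_sub_of_ratio {x ν : H → F} {a : F} {l : H → ℝ}
    (hx : ∀ᶠ s in 𝓝 0, ContDiffAt ℝ 1 x s) (hν : ∀ᶠ s in 𝓝 0, ContDiffAt ℝ 1 ν s)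
    (hl : ∀ᶠ s in 𝓝 0, ContDiffAt ℝ 1 l s)
    (hA : ∀ᶠ s in 𝓝 0, ∀ v : H,
      (inner ℝ a (x s) : ℝ) • fderiv ℝ ν s v = (inner ℝ a (ν s) : ℝ) • fderiv ℝ x s v)
    (hdense : ∀ᶠ s in 𝓝 0, s ∈ closure {t | (inner ℝ a (x t) : ℝ) ≠ 0})
    (hratio : ∀ᶠ s in 𝓝 0, (inner ℝ a (x s) : ℝ) ≠ 0 →
      l s = inner ℝ a (ν s) / inner ℝ a (x s)) :
    ∃ (c : ℝ) (b : F), ∀ᶠ s in 𝓝 0, ν s = c • x s - b := by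
  have h1 : ∀ᶠ s in 𝓝 0, l s = l 0 := by
    refine eventually_eq_of_fderiv_eq_zero_of_dense hl hdense ?_
    filter_upwards [hx, hν, hA, hratio.eventually_nhds] with s hsx hsν hsA hsr hs
    have hxd := (hsx.differentiableAt one_ne_zero).hasFDerivAt
    have hνd := (hsν.differentiableAt one_ne_zero).hasFDerivAt
    have hud := (hasFDerivAt_const a s).inner ℝ hxd
    have hmd := (hasFDerivAt_const a s).inner ℝ hνd
    have hcont : ContinuousAt (fun t => (inner ℝ a (x t) : ℝ)) s := hud.continuousAt
    have hev : l =ᶠ[𝓝 s] fun t => (inner ℝ a (ν t) : ℝ) * (inner ℝ a (x t) : ℝ)⁻¹ := by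
      filter_upwards [hsr, hcont (isOpen_ne.mem_nhds hs)] with t ht1 ht2
      rw [ht1 ht2, div_eq_mul_inv]
    rw [hev.fderiv_eq]
    refine (hmd.mul ((hasDerivAt_inv hs).comp_hasFDerivAt s hud)).fderiv.trans ?_
    ext v
    have h2 := congrArg (fun w => (inner ℝ a w : ℝ)) (hsA v)
    simp only [inner_smul_right] at h2
    simp only [add_apply, smul_apply, smul_eq_mul, fderivInnerCLM_apply,
      ContinuousLinearMap.comp_apply, ContinuousLinearMap.prod_apply, zero_apply, inner_zero_left,
      add_zero, Function.comp_apply]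
    field_simp
    linear_combination h2
  refine ⟨l 0, l 0 • x 0 - ν 0, ?_⟩
  have h2 : ∀ᶠ s in 𝓝 0, ν s - l 0 • x s = ν 0 - l 0 • x 0 := by
    refine eventually_eq_of_fderiv_eq_zero_of_dense
      (hx.mp (hν.mono fun s h h' => h.sub (contDiffAt_const.smul h'))) hdense ?_
    filter_upwards [hx, hν, hA, hratio, h1] with s hsx hsν hsA hsr hs1 hs
    have hxd := (hsx.differentiableAt one_ne_zero).hasFDerivAt
    have hνd := (hsν.differentiableAt one_ne_zero).hasFDerivAt
    refine (hνd.sub (hxd.const_smul (l 0))).fderiv.trans ?_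
    ext v
    have h3 : (inner ℝ a (ν s) : ℝ) = inner ℝ a (x s) * l 0 := by
      rw [← hs1, hsr hs, mul_div_cancel₀ _ hs]
    have h4 := hsA v
    rw [h3, mul_smul] at h4
    have h5 := smul_right_injective F hs h4
    simp only [sub_apply, smul_apply, zero_apply]
    rw [h5, sub_self]
  filter_upwards [h2] with s hs
  rw [← sub_eq_iff_eq_add'.2 (sub_eq_iff_eq_add.1 hs)]
  abel

/-- If `⟨a, x 0⟩ = 0`, apply `hA` to `e` and pair with `a`: `⟨a, x⟩⟨a, dν e⟩ = ⟨a, ν⟩⟨a, dx e⟩`. The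
ratio therefore equals `⟨a, dν e⟩ / ⟨a, dx e⟩`, which is defined across the zeros and is `C¹`
because `x` and `ν` are `C²`. Since `⟨a, dx e⟩ ≠ 0`, those zeros contain no open set. -/
theorem eventually_eq_smul_sub {x ν : H → F} {a : F}
    (hx : ContDiffAt ℝ 2 x 0) (hν : ContDiffAt ℝ 2 ν 0)
    (hA : ∀ᶠ s in 𝓝 0, ∀ v : H,
      (inner ℝ a (x s) : ℝ) • fderiv ℝ ν s v = (inner ℝ a (ν s) : ℝ) • fderiv ℝ x s v)
    (hB : (inner ℝ a (x 0) : ℝ) = 0 → ∃ e : H, (inner ℝ a (fderiv ℝ x 0 e) : ℝ) ≠ 0) :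
    ∃ (c : ℝ) (b : F), ∀ᶠ s in 𝓝 0, ν s = c • x s - b := by
  have hx2 : ∀ᶠ s in 𝓝 0, ContDiffAt ℝ 2 x s := hx.eventually (by simp)
  have hν2 : ∀ᶠ s in 𝓝 0, ContDiffAt ℝ 2 ν s := hν.eventually (by simp)
  have hx1 : ∀ᶠ s in 𝓝 0, ContDiffAt ℝ 1 x s := hx2.mono fun s h => h.of_le one_le_two
  have hν1 : ∀ᶠ s in 𝓝 0, ContDiffAt ℝ 1 ν s := hν2.mono fun s h => h.of_le one_le_two
  by_cases h0 : (inner ℝ a (x 0) : ℝ) = 0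
  · obtain ⟨e, he⟩ := hB h0
    have hxe : ∀ᶠ s in 𝓝 0, ContDiffAt ℝ 1 (fun s => (inner ℝ a (fderiv ℝ x s e) : ℝ)) s :=
      hx2.mono fun s h => contDiffAt_const.inner ℝ
        ((h.fderiv_right (m := 1) (by norm_num)).clm_apply contDiffAt_const)
    have hνe : ∀ᶠ s in 𝓝 0, ContDiffAt ℝ 1 (fun s => (inner ℝ a (fderiv ℝ ν s e) : ℝ)) s :=
      hν2.mono fun s h => contDiffAt_const.inner ℝ
        ((h.fderiv_right (m := 1) (by norm_num)).clm_apply contDiffAt_const)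
    have hne : ∀ᶠ s in 𝓝 0, (inner ℝ a (fderiv ℝ x s e) : ℝ) ≠ 0 :=
      hxe.self_of_nhds.continuousAt (isOpen_ne.mem_nhds he)
    refine eventually_eq_smul_sub_of_ratio hx1 hν1
      (l := fun s => inner ℝ a (fderiv ℝ ν s e) / inner ℝ a (fderiv ℝ x s e)) ?_ hA ?_ ?_
    · filter_upwards [hxe, hνe, hne] with s h1 h2 h3
      exact h2.div h1 h3
    · filter_upwards [hx1, hne] with s h1 h2
      rw [mem_closure_iff_frequently]
      intro hcon
      have h3 : (fun t => (inner ℝ a (x t) : ℝ)) =ᶠ[𝓝 s] fun _ => 0 :=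
        hcon.mono fun t ht => not_not.1 ht
      have hxd := (h1.differentiableAt one_ne_zero).hasFDerivAt
      have h4 := (hasFDerivAt_const a s).inner ℝ hxd
      have h5 := h3.fderiv_eq (𝕜 := ℝ)
      rw [h4.fderiv] at h5
      have h6 := DFunLike.congr_fun h5 e
      simp only [fderivInnerCLM_apply, ContinuousLinearMap.comp_apply,
        ContinuousLinearMap.prod_apply, zero_apply, inner_zero_left, add_zero, fderiv_fun_const,
        Pi.zero_apply] at h6
      exact h2 h6
    · filter_upwards [hA, hne] with s h1 h2 h3
      have h4 := congrArg (fun w => (inner ℝ a w : ℝ)) (h1 e)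
      simp only [inner_smul_right] at h4
      rw [div_eq_div_iff h2 h3]
      linear_combination h4
  · have hu : ∀ᶠ s in 𝓝 0, ContDiffAt ℝ 1 (fun s => (inner ℝ a (x s) : ℝ)) s :=
      hx1.mono fun s h => contDiffAt_const.inner ℝ h
    have hm : ∀ᶠ s in 𝓝 0, ContDiffAt ℝ 1 (fun s => (inner ℝ a (ν s) : ℝ)) s :=
      hν1.mono fun s h => contDiffAt_const.inner ℝ h
    have hne : ∀ᶠ s in 𝓝 0, (inner ℝ a (x s) : ℝ) ≠ 0 :=
      hu.self_of_nhds.continuousAt (isOpen_ne.mem_nhds h0)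
    refine eventually_eq_smul_sub_of_ratio hx1 hν1
      (l := fun s => inner ℝ a (ν s) / inner ℝ a (x s)) ?_ hA ?_ ?_
    · filter_upwards [hu, hm, hne] with s h1 h2 h3
      exact h2.div h1 h3
    · exact hne.mono fun s h => subset_closure h
    · exact Filter.Eventually.of_forall fun s _ => rfl

end LocalRigidity

/-! ### Parametrization of a regular level set -/

/-- A regular level set is locally the image of the kernel of the differential. -/
theorem exists_parametrization {n : ℕ} {f : Euc n → ℝ} (hf : ContDiff ℝ ∞ f) (h0 : f 0 = 0)
    (hd : fderiv ℝ f 0 ≠ 0) :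
    ∃ ψ : Euc n → Euc n, ContDiffAt ℝ ∞ ψ 0 ∧ ψ 0 = 0 ∧
      HasFDerivAt ψ (ContinuousLinearMap.id ℝ (Euc n)) 0 ∧
      (∀ᶠ z in 𝓝 0, f (ψ z) = fderiv ℝ f 0 z) ∧
      ∀ P : Euc n → Prop, (∀ᶠ z in 𝓝 0, fderiv ℝ f 0 z = 0 → P (ψ z)) →
        ∀ᶠ y in 𝓝 0, f y = 0 → P y := by
  obtain ⟨e, he⟩ : ∃ e, fderiv ℝ f 0 e ≠ 0 := by
    by_contra! hcon
    exact hd (ContinuousLinearMap.ext hcon)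
  set l := fderiv ℝ f 0
  -- `Φ` is chosen so that `l ∘ Φ = f` and `dΦ(0) = id`: it straightens the level set, and `ψ` is
  -- its local inverse.
  set Φ : Euc n → Euc n := fun y => y + ((f y - l y) / l e) • e with hΦ
  have hΦs : ContDiff ℝ ∞ Φ :=
    contDiff_id.add (((hf.sub l.contDiff).div_const _).smul contDiff_const)
  have hΦ0 : Φ 0 = 0 := by simp [hΦ, h0]
  have hlΦ : ∀ y, l (Φ y) = f y := by
    intro y
    rw [hΦ, map_add, map_smul, smul_eq_mul, div_mul_cancel₀ _ he]
    ring
  have hΦd : HasFDerivAt Φ ((ContinuousLinearEquiv.refl ℝ (Euc n) : Euc n ≃L[ℝ] Euc n) :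
      Euc n →L[ℝ] Euc n) 0 := by
    have h1 : HasFDerivAt f l 0 := (hf.differentiable (by simp) 0).hasFDerivAt
    have h2 := (hasFDerivAt_id (0 : Euc n)).add
      (((h1.sub l.hasFDerivAt).mul_const (l e)⁻¹).smul_const e)
    refine h2.congr_fderiv ?_
    ext v
    simp
  have hs : HasStrictFDerivAt Φ ((ContinuousLinearEquiv.refl ℝ (Euc n) : Euc n ≃L[ℝ] Euc n) :
      Euc n →L[ℝ] Euc n) 0 := hΦs.contDiffAt.hasStrictFDerivAt' hΦd (by simp)
  have hψs := hΦs.contDiffAt.to_localInverse (n := ∞) hΦd (by simp)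
  have hψ0 := hs.localInverse_apply_image
  have hψd := hs.to_localInverse.hasFDerivAt
  have hr := hs.eventually_right_inverse
  have hl := hs.eventually_left_inverse
  rw [hΦ0] at hψs hψ0 hψd hr
  refine ⟨hs.localInverse Φ _ 0, hψs, hψ0, hψd, ?_, fun P hP => ?_⟩
  · filter_upwards [hr] with z hz
    rw [← hlΦ, hz]
  · have ht : Filter.Tendsto Φ (𝓝 0) (𝓝 0) := by
      have := hΦs.continuous.tendsto 0
      rwa [hΦ0] at this
    -- Every zero `y` of `f` near the origin is `ψ (Φ y)` with `Φ y` in the kernel of `l`, so `ψ`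
    -- covers the whole level set.
    filter_upwards [hl, ht.eventually hP] with y hy1 hy2 hy3
    rw [← hy1]
    exact hy2 (by rw [hlΦ, hy3])

/-! ### The outward normal along the boundary -/

section Rigidity

variable {Ω : Set (UnitSphere n)} {p : UnitSphere n} {ρ : UnitSphere n → ℝ}

/-- The gradient of the homogeneous extension, normalized. -/
def unitGradient (ρ : UnitSphere n → ℝ) (z : Euc (n + 1)) : Euc (n + 1) :=
  ‖gradient (homExt ρ) z‖⁻¹ • gradient (homExt ρ) z

theorem contDiffAt_gradient_homExt (hρ : ContMDiff (𝓡 n) 𝓘(ℝ, ℝ) ∞ ρ) {z : Euc (n + 1)}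
    (hz : z ≠ 0) : ContDiffAt ℝ ∞ (gradient (homExt ρ)) z :=
  ((InnerProductSpace.toDual ℝ (Euc (n + 1))).symm.contDiff.contDiffAt).comp z
    (contDiffAt_fderiv_homExt hρ hz)

theorem IsDefiningFunction.gradient_homExt_ne_zero (h : IsDefiningFunction n Ω p ρ) :
    gradient (homExt ρ) (p : Euc (n + 1)) ≠ 0 := by
  rw [← h.frame_gradient]
  exact fun h0 => h.gradient_ne_zero
    ((tangentFrame p).injective (h0.trans (map_zero _).symm))

theorem IsDefiningFunction.inner_gradient_homExt (h : IsDefiningFunction n Ω p ρ) :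
    inner ℝ (p : Euc (n + 1)) (gradient (homExt ρ) (p : Euc (n + 1))) = (0 : ℝ) := by
  rw [← h.frame_gradient, inner_point_frame]

theorem IsDefiningFunction.norm_unitGradient (h : IsDefiningFunction n Ω p ρ) :
    ‖unitGradient ρ p‖ = 1 := by
  rw [unitGradient, norm_smul, norm_inv, norm_norm,
    inv_mul_cancel₀ (norm_ne_zero_iff.2 h.gradient_homExt_ne_zero)]

theorem IsDefiningFunction.inner_unitGradient (h : IsDefiningFunction n Ω p ρ) :
    inner ℝ (p : Euc (n + 1)) (unitGradient ρ p) = (0 : ℝ) := by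
  rw [unitGradient, inner_smul_right, h.inner_gradient_homExt, mul_zero]

theorem IsDefiningFunction.contDiffAt_unitGradient (h : IsDefiningFunction n Ω p ρ) :
    ContDiffAt ℝ ∞ (unitGradient ρ) (p : Euc (n + 1)) := by
  have hG := contDiffAt_gradient_homExt h.1 (unitSphere_ne_zero p)
  exact ((hG.norm ℝ h.gradient_homExt_ne_zero).inv
    (norm_ne_zero_iff.2 h.gradient_homExt_ne_zero)).smul hG

/-- The unit normal built from `ρ` is a positive multiple of the gradient of any other defining
function, and unit length fixes the factor. -/
theorem IsDefiningFunction.unitGradient_eq {ρ' : UnitSphere n → ℝ}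
    (h : IsDefiningFunction n Ω p ρ) (h' : IsDefiningFunction n Ω p ρ') :
    unitGradient ρ (p : Euc (n + 1)) = unitGradient ρ' p := by
  obtain ⟨c, hc, hcν⟩ := h.isOutwardUnitNormal.exists_smul h'
  have h1 : unitGradient ρ (p : Euc (n + 1)) = c • gradient (homExt ρ') (p : Euc (n + 1)) := by
    have h2 : tangentFrame p (‖gradient (inChart (n := n) ρ p) 0‖⁻¹ •
        gradient (inChart (n := n) ρ p) 0) =
        tangentFrame p (c • gradient (inChart (n := n) ρ' p) 0) := congrArg (tangentFrame p) hcν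
    rw [map_smul, map_smul, h'.frame_gradient, ← (tangentFrame p).norm_map,
      h.frame_gradient] at h2
    exact h2
  have h3 := h.norm_unitGradient
  rw [h1, norm_smul, Real.norm_of_nonneg hc.le] at h3
  rw [h1, unitGradient, eq_inv_of_mul_eq_one_left h3]

theorem inner_unitGradient_left (ρ : UnitSphere n → ℝ) (z w : Euc (n + 1)) :
    inner ℝ (unitGradient ρ z) w = ‖gradient (homExt ρ) z‖⁻¹ * fderiv ℝ (homExt ρ) z w := by
  rw [unitGradient, inner_smul_left, inner_gradient]
  simp

/-- The derivative of the unit normal along a curve in the boundary, when the boundary condition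
holds with the static potential `⟨a, x⟩`. -/
theorem smul_fderiv_unitGradient {H : Type*} [NormedAddCommGroup H] [NormedSpace ℝ H]
    {x : H → Euc (n + 1)} {q : H → UnitSphere n} {s : H} {a : Euc (n + 1)}
    (hq : ∀ t, (q t : Euc (n + 1)) = x t) (hx : DifferentiableAt ℝ x s)
    (hdef : ∀ᶠ t in 𝓝 s, IsDefiningFunction n Ω (q t) ρ)
    (hB : ∀ v w : Euc (n + 1), inner ℝ (x s) v = (0 : ℝ) → inner ℝ (x s) w = (0 : ℝ) →
      fderiv ℝ (homExt ρ) (x s) v = 0 → fderiv ℝ (homExt ρ) (x s) w = 0 →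
      inner ℝ a (gradient (homExt ρ) (x s)) * inner ℝ v w =
        inner ℝ a (x s) * fderiv ℝ (fderiv ℝ (homExt ρ)) (x s) v w) (v : H) :
    (inner ℝ a (x s) : ℝ) • fderiv ℝ (fun t => unitGradient ρ (x t)) s v =
      (inner ℝ a (unitGradient ρ (x s)) : ℝ) • fderiv ℝ x s v := by
  have hds := hdef.self_of_nhds
  have hρ := hds.1
  set ν : H → Euc (n + 1) := fun t => unitGradient ρ (x t) with hν
  set G := gradient (homExt ρ) (x s) with hG
  have hG0 : G ≠ 0 := by rw [hG, ← hq]; exact hds.gradient_homExt_ne_zero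
  have hβ : ‖G‖⁻¹ ≠ 0 := inv_ne_zero (norm_ne_zero_iff.2 hG0)
  have hxs : x s ≠ 0 := by rw [← hq]; exact unitSphere_ne_zero _
  have hxd := hx.hasFDerivAt
  have hGd : DifferentiableAt ℝ (fun t => gradient (homExt ρ) (x t)) s :=
    ((contDiffAt_gradient_homExt hρ hxs).differentiableAt (by simp)).comp s hx
  have hβd : DifferentiableAt ℝ (fun t => ‖gradient (homExt ρ) (x t)‖⁻¹) s :=
    (hGd.norm ℝ hG0).inv (norm_ne_zero_iff.2 hG0)
  have hνd : HasFDerivAt ν (fderiv ℝ ν s) s := (hβd.smul hGd).hasFDerivAt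
  set X := fderiv ℝ x s v
  set Y := fderiv ℝ ν s v
  have hRx : HasFDerivAt (fun t => fderiv ℝ (homExt ρ) (x t))
      ((fderiv ℝ (fderiv ℝ (homExt ρ)) (x s)).comp (fderiv ℝ x s)) s :=
    (differentiableAt_fderiv_homExt hρ hxs).hasFDerivAt.comp s hxd
  have hderiv : ∀ {A B : H → Euc (n + 1)} {A' B' : H →L[ℝ] Euc (n + 1)} {k : ℝ},
      HasFDerivAt A A' s → HasFDerivAt B B' s → (∀ᶠ t in 𝓝 s, (inner ℝ (A t) (B t) : ℝ) = k) →
      inner ℝ (A s) (B' v) + inner ℝ (A' v) (B s) = (0 : ℝ) := by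
    intro A B A' B' k hA hB hk
    have h1 := (hA.inner ℝ hB).fderiv
    have h2 : (fun t => (inner ℝ (A t) (B t) : ℝ)) =ᶠ[𝓝 s] fun _ => k := hk
    have h3 := h2.fderiv_eq (𝕜 := ℝ)
    rw [h1] at h3
    simpa using DFunLike.congr_fun h3 v
  have h1 : inner ℝ (x s) X = (0 : ℝ) := by
    have := hderiv hxd hxd (k := 1) (Filter.Eventually.of_forall fun t => by
      rw [← hq, inner_self_unitSphere])
    rw [real_inner_comm (x s)] at this
    linarith
  have h2 : fderiv ℝ (homExt ρ) (x s) X = 0 := by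
    have h3 := (differentiableAt_homExt hρ hxs).hasFDerivAt.comp s hxd
    have h4 : homExt ρ ∘ x =ᶠ[𝓝 s] fun _ => 0 := by
      filter_upwards [hdef] with t ht
      rw [Function.comp_apply, ← hq, homExt_coe, ht.2.1]
    have h5 := h4.fderiv_eq (𝕜 := ℝ)
    rw [h3.fderiv] at h5
    simpa using DFunLike.congr_fun h5 v
  have h3 : inner ℝ (ν s) Y = (0 : ℝ) := by
    have := hderiv hνd hνd (k := 1) (by
      filter_upwards [hdef] with t ht
      rw [real_inner_self_eq_norm_sq, hν]
      simp only [← hq]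
      rw [ht.norm_unitGradient]
      norm_num)
    rw [real_inner_comm (ν s)] at this
    linarith
  have h4 : inner ℝ (x s) Y = (0 : ℝ) := by
    have := hderiv hxd hνd (k := 0) (by
      filter_upwards [hdef] with t ht
      rw [hν]
      simp only [← hq]
      exact ht.inner_unitGradient)
    have h5 : inner ℝ X (ν s) = (0 : ℝ) := by
      rw [real_inner_comm, hν, inner_unitGradient_left, h2, mul_zero]
    change inner ℝ (x s) Y + inner ℝ X (ν s) = (0 : ℝ) at this
    linarith
  have h5 : fderiv ℝ (homExt ρ) (x s) Y = 0 := by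
    rw [hν, inner_unitGradient_left] at h3
    exact (mul_eq_zero.1 h3).resolve_left hβ
  -- The derivative of the normalizing factor `‖∇R‖⁻¹` is multiplied by `dR(w) = 0` and drops out.
  have h6 : ∀ w, fderiv ℝ (homExt ρ) (x s) w = 0 →
      inner ℝ Y w = ‖G‖⁻¹ * fderiv ℝ (fderiv ℝ (homExt ρ)) (x s) X w := by
    intro w hw
    have h7 := (hνd.inner ℝ (hasFDerivAt_const w s)).fderiv
    have h8 := (hβd.hasFDerivAt.mul (hRx.clm_apply (hasFDerivAt_const w s))).fderiv
    have h9 : (fun t => (inner ℝ (ν t) w : ℝ)) = fun t =>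
        ‖gradient (homExt ρ) (x t)‖⁻¹ * fderiv ℝ (homExt ρ) (x t) w :=
      funext fun t => inner_unitGradient_left ρ (x t) w
    rw [h9] at h7
    have h10 := DFunLike.congr_fun (h7.symm.trans h8) v
    simpa [hw] using h10
  rw [← sub_eq_zero]
  -- `r` is tangent to the boundary, hence an admissible test vector; the condition for the pair `X,
  -- r` yields `⟨r, r⟩ = 0`.
  set r := (inner ℝ a (x s) : ℝ) • Y - (inner ℝ a (ν s) : ℝ) • X with hr
  have hr1 : inner ℝ (x s) r = (0 : ℝ) := by
    rw [hr, inner_sub_right, inner_smul_right, inner_smul_right, h1, h4]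
    ring
  have hr2 : fderiv ℝ (homExt ρ) (x s) r = 0 := by
    rw [hr, map_sub, map_smul, map_smul, h2, h5]
    simp
  have h7 := hB X r h1 hr1 h2 hr2
  have h8 : (inner ℝ a (ν s) : ℝ) = ‖G‖⁻¹ * inner ℝ a G := by
    change inner ℝ a (‖G‖⁻¹ • G) = _
    rw [inner_smul_right]
  have h9 : inner ℝ r r = (0 : ℝ) := by
    change inner ℝ ((inner ℝ a (x s) : ℝ) • Y - (inner ℝ a (ν s) : ℝ) • X) r = (0 : ℝ)
    rw [inner_sub_left, inner_smul_left, inner_smul_left, h6 r hr2, h8]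
    simp only [conj_trivial]
    linear_combination (-‖G‖⁻¹) * h7
  exact inner_self_eq_zero.1 h9

/-- Near each boundary point the unit normal is an affine function of position. -/
theorem exists_unitGradient_eq (hn : 2 ≤ n) (ho : IsOpen Ω) (h : IsDefiningFunction n Ω p ρ)
    {a : Euc (n + 1)} (ha : a ≠ 0)
    (hB : ∀ q ∈ frontier Ω, ∀ ρ : UnitSphere n → ℝ, IsDefiningFunction n Ω q ρ →
      ∀ v w : Euc (n + 1), inner ℝ (q : Euc (n + 1)) v = (0 : ℝ) →
        inner ℝ (q : Euc (n + 1)) w = (0 : ℝ) → fderiv ℝ (homExt ρ) q v = 0 →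
        fderiv ℝ (homExt ρ) q w = 0 →
        inner ℝ a (gradient (homExt ρ) (q : Euc (n + 1))) * inner ℝ v w =
          inner ℝ a (q : Euc (n + 1)) * fderiv ℝ (fderiv ℝ (homExt ρ)) q v w) :
    ∃ (c : ℝ) (b : Euc (n + 1)), ∀ᶠ q : UnitSphere n in 𝓝[frontier Ω] p,
      unitGradient ρ (q : Euc (n + 1)) = c • (q : Euc (n + 1)) - b := by
  set f := inChart (n := n) ρ p with hf
  have hf0 : f 0 = 0 := by rw [hf, inChart, Function.comp_apply, chart_symm_zero, h.2.1]
  obtain ⟨ψ, hψs, hψ0, hψd, hψf, hψP⟩ :=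
    exists_parametrization (contDiff_inChart h.1 p) hf0 h.fderiv_ne_zero
  -- The boundary is parametrized by the tangent hyperplane `K`, so that the rigidity lemma applies
  -- on a normed space.
  set K : Submodule ℝ (Euc n) := LinearMap.ker (fderiv ℝ f 0).toLinearMap with hK
  have hKmem : ∀ s : K, fderiv ℝ f 0 s = 0 := fun s => LinearMap.mem_ker.1 s.2
  set x : K → Euc (n + 1) := fun s => stereoMap p (ψ s) with hx
  set q : K → UnitSphere n := fun s => (chartAt (Euc n) p).symm (ψ s) with hqdef
  have hq : ∀ s, (q s : Euc (n + 1)) = x s := fun s => coe_chart_symm p _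
  have hx0 : x 0 = p := by
    change stereoMap p (ψ 0) = p
    rw [hψ0, stereoMap_zero]
  have hsub : ContDiff ℝ ∞ (fun s : K => (s : Euc n)) := K.subtypeL.contDiff
  have hψK : ContDiffAt ℝ ∞ (fun s : K => ψ s) 0 := hψs.comp (0 : K) hsub.contDiffAt
  have hxs : ContDiffAt ℝ ∞ x 0 :=
    ((contDiff_stereoMap p).of_le le_top).contDiffAt.comp (0 : K) hψK
  have hνs : ContDiffAt ℝ ∞ (fun s => unitGradient ρ (x s)) 0 := by
    have h1 := h.contDiffAt_unitGradient
    rw [← hx0] at h1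
    exact h1.comp (0 : K) hxs
  have hqt : Filter.Tendsto q (𝓝 0) (𝓝 p) := by
    have h1 : ContinuousAt q 0 :=
      (contMDiff_chart_symm p).continuous.continuousAt.comp hψK.continuousAt
    have h2 : q 0 = p := Subtype.ext ((hq 0).trans hx0)
    rw [ContinuousAt, h2] at h1
    exact h1
  have hρq : ∀ᶠ s in 𝓝 (0 : K), ρ (q s) = 0 := by
    have h1 : Filter.Tendsto (fun s : K => (s : Euc n)) (𝓝 0) (𝓝 0) :=
      hsub.continuous.tendsto 0
    filter_upwards [h1.eventually hψf] with s hs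
    exact hs.trans (hKmem s)
  have hdef : ∀ᶠ s in 𝓝 (0 : K), q s ∈ frontier Ω ∧ IsDefiningFunction n Ω (q s) ρ := by
    filter_upwards [hρq, hqt.eventually (h.eventually ho)] with s h1 h2
    exact ⟨h2.1.2 h1, h2.2 h1⟩
  have hxev : ∀ᶠ s in 𝓝 (0 : K), DifferentiableAt ℝ x s :=
    ((hxs.of_le (by simp : (1 : ℕ∞ω) ≤ ∞)).eventually (by simp)).mono fun s hs =>
      hs.differentiableAt one_ne_zero
  have h2le : (2 : ℕ∞ω) ≤ ∞ := by simpa using WithTop.coe_le_coe.2 (le_top : (2 : ℕ∞) ≤ ⊤)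
  obtain ⟨c, b, hcb⟩ := eventually_eq_smul_sub (a := a) (hxs.of_le h2le) (hνs.of_le h2le) (by
      filter_upwards [hxev, hdef.eventually_nhds] with s hs1 hs2
      have hs3 := hs2.self_of_nhds
      refine smul_fderiv_unitGradient hq hs1 (hs2.mono fun t ht => ht.2) ?_
      rw [← hq]
      exact hB (q s) hs3.1 ρ hs3.2) (by
      intro h0
      have hp := h.mem_frontier ho
      rw [hx0] at h0
      -- At a boundary zero of `⟨a, x⟩` the condition on a nonzero tangent vector gives `⟨a, ∇R⟩ =
      -- 0`. So `a` is tangent to the boundary and is itself the direction sought: the derivative of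
      -- `⟨a, x⟩` along it is `⟨a, a⟩ ≠ 0`.
      have haG : inner ℝ a (gradient (homExt ρ) (p : Euc (n + 1))) = (0 : ℝ) := by
        obtain ⟨v, hv, hpv, hGv⟩ := exists_ne_zero_orthogonal hn (p : Euc (n + 1))
          (gradient (homExt ρ) (p : Euc (n + 1)))
        rw [inner_gradient] at hGv
        have h1 := hB p hp ρ h v v hpv hpv hGv hGv
        rw [h0, zero_mul] at h1
        exact (mul_eq_zero.1 h1).resolve_right (real_inner_self_pos.2 hv).ne'
      obtain ⟨y, hy⟩ := exists_frame_eq p (w := a) (by rw [real_inner_comm]; exact h0)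
      have hyK : y ∈ K := by
        rw [hK, LinearMap.mem_ker]
        change fderiv ℝ f 0 y = 0
        rw [hf, fderiv_inChart_zero h.1, hy, ← inner_gradient, real_inner_comm]
        exact haG
      refine ⟨⟨y, hyK⟩, ?_⟩
      have h1 : HasFDerivAt (fun s : K => ψ s)
          ((ContinuousLinearMap.id ℝ (Euc n)).comp K.subtypeL) 0 :=
        HasFDerivAt.comp (0 : K) (g := ψ) (f := fun s : K => (s : Euc n)) hψd
          K.subtypeL.hasFDerivAt
      have h2 : HasFDerivAt (stereoMap p) (fderiv ℝ (stereoMap p) 0) (ψ ((0 : K) : Euc n)) := by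
        change HasFDerivAt (stereoMap p) (fderiv ℝ (stereoMap p) 0) (ψ 0)
        rw [hψ0]
        exact (hasFDerivAt_stereoMap p 0).differentiableAt.hasFDerivAt
      have h3 : fderiv ℝ x 0 ⟨y, hyK⟩ = a := by
        have h4 := (HasFDerivAt.comp (0 : K) (g := stereoMap p) (f := fun s : K => ψ s) h2 h1).fderiv
        refine (DFunLike.congr_fun h4 _).trans ?_
        change fderiv ℝ (stereoMap p) 0 y = a
        rw [fderiv_stereoMap_zero, hy]
      rw [h3]
      exact (real_inner_self_pos.2 ha).ne')
  refine ⟨c, b, ?_⟩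
  have h1 := hψP (fun y => unitGradient ρ (stereoMap p y) = c • stereoMap p y - b) (by
    rw [nhds_subtype_eq_comap, Filter.eventually_comap] at hcb
    filter_upwards [hcb] with z hz hz0
    exact hz ⟨z, LinearMap.mem_ker.2 hz0⟩ rfl)
  set φ := chartAt (Euc n) p
  have hφt : Filter.Tendsto φ (𝓝 p) (𝓝 0) := by
    have := φ.continuousAt (mem_chart_source _ p)
    rwa [ContinuousAt, chart_self] at this
  filter_upwards [mem_nhdsWithin_of_mem_nhds (hφt.eventually h1),
    mem_nhdsWithin_of_mem_nhds (chart_source_mem_nhds (Euc n) p),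
    eventually_nhdsWithin_of_eventually_nhds (h.eventually ho), self_mem_nhdsWithin] with z hz1 hz2 hz3 hz4
  have h2 : stereoMap p (φ z) = z := by rw [← coe_chart_symm, φ.left_inv hz2]
  have h3 : f (φ z) = 0 := by
    rw [hf, inChart, Function.comp_apply, φ.left_inv hz2]
    exact hz3.1.1 hz4
  have h4 := hz1 h3
  rwa [h2] at h4

end Rigidity

/-! ### Domains with connected boundary -/

section Global

variable {Ω : Set (UnitSphere n)}

open Classical in
/-- The outward unit normal at a boundary point, as a vector of `ℝⁿ⁺¹`. -/
def outwardNormal (Ω : Set (UnitSphere n)) (q : UnitSphere n) : Euc (n + 1) :=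
  if h : ∃ ρ, IsDefiningFunction n Ω q ρ then unitGradient h.choose q else 0

theorem IsDefiningFunction.outwardNormal_eq {q : UnitSphere n} {ρ : UnitSphere n → ℝ}
    (h : IsDefiningFunction n Ω q ρ) : outwardNormal Ω q = unitGradient ρ q := by
  have h1 : ∃ ρ, IsDefiningFunction n Ω q ρ := ⟨ρ, h⟩
  rw [outwardNormal, dif_pos h1]
  exact h1.choose_spec.unitGradient_eq h

/-- Boundary points are not isolated in the boundary. -/
theorem eq_zero_of_eventually_smul_eq (hn : 2 ≤ n) (hΩ : IsSmoothDomain n Ω) {p : UnitSphere n}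
    (hp : p ∈ frontier Ω) {d : ℝ} {b : Euc (n + 1)}
    (h : ∀ᶠ q : UnitSphere n in 𝓝[frontier Ω] p, d • (q : Euc (n + 1)) = b) : d = 0 := by
  obtain ⟨ρ, hρ⟩ := hΩ.smooth_boundary p hp
  obtain ⟨v, hv, hpv, hGv⟩ := exists_ne_zero_orthogonal hn (p : Euc (n + 1))
    (gradient (homExt ρ) (p : Euc (n + 1)))
  obtain ⟨v, rfl⟩ := exists_frame_eq p hpv
  rw [inner_gradient, ← fderiv_inChart_zero hρ.1] at hGv
  set f := inChart (n := n) ρ p with hf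
  set l : Euc (n + 1) →L[ℝ] ℝ := innerSL ℝ (tangentFrame p v)
  have ht : Filter.Tendsto (chartAt (Euc n) p).symm (𝓝 0) (𝓝 p) := by
    have := (contMDiff_chart_symm p).continuous.tendsto 0
    rwa [chart_symm_zero] at this
  -- Pair `d • q = b` with a nonzero boundary tangent vector and differentiate along that same
  -- vector: this leaves `d` times its squared norm.
  have h1 : fderiv ℝ (fun y => d * l (stereoMap p y) - l b) 0 v = 0 := by
    refine fderiv_eq_zero_of_eventually_zero
      (((contDiff_inChart hρ.1 p).of_le (by simp)).contDiffAt) ?_ ?_ hρ.fderiv_ne_zero ?_ hGv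
    · exact ((contDiff_const.mul (l.contDiff.comp ((contDiff_stereoMap p).of_le le_top))).sub
        contDiff_const).contDiffAt
    · rw [← hf, hf, inChart, Function.comp_apply, chart_symm_zero, hρ.2.1]
    · filter_upwards [ht.eventually (eventually_nhdsWithin_iff.1 h),
        ht.eventually (hρ.eventually hΩ.isOpen)] with y hy1 hy2 hy3
      have h2 := hy1 (hy2.1.2 hy3)
      rw [coe_chart_symm] at h2
      rw [← h2, map_smul, smul_eq_mul, sub_self]
  have h2 : HasFDerivAt (fun y => d * l (stereoMap p y) - l b)
      (d • l.comp (fderiv ℝ (stereoMap p) 0)) 0 :=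
    ((l.hasFDerivAt.comp (0 : Euc n)
      (hasFDerivAt_stereoMap p 0).differentiableAt.hasFDerivAt).const_mul d).sub_const _
  rw [h2.fderiv] at h1
  simp only [smul_apply, ContinuousLinearMap.comp_apply, fderiv_stereoMap_zero] at h1
  exact (mul_eq_zero.1 h1).resolve_right (real_inner_self_pos.2 hv).ne'

/-- The boundary of a non-generic domain, if connected, has constant principal curvature. -/
theorem exists_outwardNormal_eq (hn : 2 ≤ n)
    (hΩ : IsSimpleNonGenericDomain (roundMetric n) Ω) :
    ∃ (c : ℝ) (b : Euc (n + 1)), ∀ q ∈ frontier Ω,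
      outwardNormal Ω q = c • (q : Euc (n + 1)) - b := by
  obtain ⟨⟨hdom, u, hu, hu0⟩, hconn⟩ := hΩ
  obtain ⟨a, hua, hB⟩ := exists_inner_of_mem_kerPhiStar hn hdom hu
  have ha : a ≠ 0 := by
    rintro rfl
    exact hu0 (funext fun x => by rw [hua, inner_zero_left]; rfl)
  set germ : UnitSphere n → ℝ → Euc (n + 1) → Prop := fun p c b =>
    ∀ᶠ q : UnitSphere n in 𝓝[frontier Ω] p, outwardNormal Ω q = c • (q : Euc (n + 1)) - b with hgerm
  have hex : ∀ p ∈ frontier Ω, ∃ c b, germ p c b := by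
    intro p hp
    obtain ⟨ρ, hρ⟩ := hdom.smooth_boundary p hp
    obtain ⟨c, b, h⟩ := exists_unitGradient_eq hn hdom.isOpen hρ ha hB
    refine ⟨c, b, ?_⟩
    filter_upwards [h, eventually_nhdsWithin_of_eventually_nhds (hρ.eventually hdom.isOpen),
      self_mem_nhdsWithin] with q h1 h2 h3
    rw [(h2.2 (h2.1.1 h3)).outwardNormal_eq, h1]
  have huniq : ∀ p ∈ frontier Ω, ∀ c b c' b', germ p c b → germ p c' b' → c = c' ∧ b = b' := by
    intro p hp c b c' b' h h'
    have h1 : c = c' := by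
      refine sub_eq_zero.1 (eq_zero_of_eventually_smul_eq hn hdom hp (b := b - b') ?_)
      filter_upwards [h, h'] with q hq hq'
      rw [hq] at hq'
      rw [sub_smul, sub_eq_sub_iff_sub_eq_sub]
      exact hq'
    subst h1
    refine ⟨rfl, ?_⟩
    have h2 := h.self_of_nhdsWithin hp
    rw [h'.self_of_nhdsWithin hp] at h2
    exact (sub_right_injective h2).symm
  obtain ⟨p, hp⟩ := hconn.nonempty
  obtain ⟨c, b, hcb⟩ := hex p hp
  refine ⟨c, b, fun q hq => ?_⟩
  -- The germ `(c, b)` is propagated along the connected boundary; uniqueness of the germ at each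
  -- point makes this relation symmetric and lets it hold locally.
  have key := hconn.isPreconnected.induction₂ (fun x y => ∀ c b, germ x c b → germ y c b)
    (fun x hx => by
      obtain ⟨c₀, b₀, h₀⟩ := hex x hx
      have h1 := eventually_eventually_nhdsWithin.2 h₀
      filter_upwards [h1] with y hy c b h
      obtain ⟨rfl, rfl⟩ := huniq x hx _ _ _ _ h h₀
      exact hy)
    (fun x y z _ _ _ h1 h2 c b h => h2 c b (h1 c b h))
    (fun x y hx hy h c b hyc => by
      obtain ⟨c₀, b₀, h₀⟩ := hex x hx
      obtain ⟨rfl, rfl⟩ := huniq y hy _ _ _ _ hyc (h _ _ h₀)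
      exact h₀) hp hq
  exact (key c b hcb).self_of_nhdsWithin hq

/-- A boundary contained in a small sphere forces the domain to be a cap. -/
theorem isSphericalCap_of_frontier_subset (hΩ : IsSmoothDomain n Ω)
    (hne : (frontier Ω).Nonempty) {N : UnitSphere n} {c : ℝ} (hc : |c| < 1)
    (h : ∀ q ∈ frontier Ω, inner ℝ (N : Euc (n + 1)) (q : Euc (n + 1)) = c) :
    IsSphericalCap Ω := by
  obtain ⟨hc1, hc2⟩ := abs_lt.1 hc
  set θ := Real.arccos c with hθ
  have hcos : Real.cos θ = c := Real.cos_arccos hc1.le hc2.le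
  have h0 : 0 < θ := Real.arccos_pos.2 hc2
  have hπ : θ < Real.pi :=
    lt_of_le_of_ne (Real.arccos_le_pi c) fun h => hc1.not_ge (Real.arccos_eq_pi.1 h)
  have h0' : 0 < Real.pi - θ := by linarith
  have hπ' : Real.pi - θ < Real.pi := by linarith
  have hneg : ((-N : UnitSphere n) : Euc (n + 1)) = -(N : Euc (n + 1)) := rfl
  have hA : ∀ x, x ∈ sphericalCap N θ ↔ c < inner ℝ (N : Euc (n + 1)) (x : Euc (n + 1)) :=
    fun x => by rw [mem_sphericalCap_iff h0 hπ, hcos]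
  have hB : ∀ x, x ∈ sphericalCap (-N) (Real.pi - θ) ↔
      inner ℝ (N : Euc (n + 1)) (x : Euc (n + 1)) < c := fun x => by
    rw [mem_sphericalCap_iff h0' hπ', Real.cos_pi_sub, hcos, hneg, inner_neg_left, neg_lt_neg_iff]
  have hAf : ∀ x : UnitSphere n, inner ℝ (N : Euc (n + 1)) (x : Euc (n + 1)) = c →
      x ∈ closure (sphericalCap N θ) ∧ x ∈ closure (sphericalCap (-N) (Real.pi - θ)) := by
    intro x hx
    constructor <;> apply frontier_subset_closure
    · rw [mem_frontier_sphericalCap_iff h0 hπ, capFun, hcos, hx, sub_self]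
    · rw [mem_frontier_sphericalCap_iff h0' hπ', capFun, Real.cos_pi_sub, hcos, hneg,
        inner_neg_left, hx, sub_self]
  -- A connected set off the small sphere misses the frontier, so it lies in `Ω` or in the
  -- complement of the closure.
  have hsplit : ∀ S : Set (UnitSphere n), IsConnected S →
      (∀ x ∈ S, inner ℝ (N : Euc (n + 1)) (x : Euc (n + 1)) ≠ c) → S ⊆ Ω ∨ S ⊆ (closure Ω)ᶜ := by
    intro S hS hSc
    refine hS.isPreconnected.subset_or_subset hΩ.isOpen isClosed_closure.isOpen_compl
      (disjoint_compl_right.mono_left subset_closure) ?_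
    intro x hx
    by_cases hxc : x ∈ closure Ω
    · left
      by_contra hxΩ
      exact hSc x hx (h x (hΩ.isOpen.frontier_eq ▸ ⟨hxc, hxΩ⟩))
    · exact Or.inr hxc
  have hcapA := (isSmoothDomain_sphericalCap (N := N) h0 hπ)
  have hcapB := (isSmoothDomain_sphericalCap (N := -N) h0' hπ')
  have hsA := hsplit _ hcapA.isConnected fun x hx => ((hA x).1 hx).ne'
  have hsB := hsplit _ hcapB.isConnected fun x hx => ((hB x).1 hx).ne
  have hmeet : ∀ S : Set (UnitSphere n), S ⊆ (closure Ω)ᶜ → ∀ x ∈ Ω, x ∉ closure S := by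
    intro S hS x hx hxS
    obtain ⟨y, hy1, hy2⟩ := mem_closure_iff.1 hxS Ω hΩ.isOpen hx
    exact hS hy2 (subset_closure hy1)
  rcases hsA with hsA | hsA <;> rcases hsB with hsB | hsB
  -- Both caps inside `Ω` would make `Ω` dense, but following an outward direction at a boundary
  -- point reaches points with `ρ > 0`, near which `Ω` is absent.
  · exfalso
    have hdense : closure Ω = Set.univ := by
      refine Set.eq_univ_of_forall fun x => ?_
      rcases lt_trichotomy (inner ℝ (N : Euc (n + 1)) (x : Euc (n + 1))) c with hx | hx | hx
      · exact subset_closure (hsB ((hB x).2 hx))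
      · exact closure_mono hsA (hAf x hx).1
      · exact subset_closure (hsA ((hA x).2 hx))
    obtain ⟨p, hp⟩ := hne
    obtain ⟨ρ, hρ⟩ := hΩ.smooth_boundary p hp
    obtain ⟨v, hv⟩ := hρ.exists_fderiv_neg
    have hneg : ContMDiff (𝓡 n) 𝓘(ℝ, ℝ) ∞ (-ρ) := hρ.1.neg
    have h2 := eventually_neg_of_fderiv_neg (p := p) hneg (v := -v) (by simp [hρ.2.1]) (by
      have : inChart (n := n) (-ρ) p = -inChart (n := n) ρ p := rfl
      rw [this, fderiv_neg]
      simpa using hv)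
    obtain ⟨t, ht1, ht2⟩ :=
      (h2.and ((tendsto_chart_symm_smul p (-v)).eventually hρ.2.2.2.eventually_nhds)).exists
    set x := (chartAt (Euc n) p).symm (t • -v)
    have hx : x ∈ closure Ω := by rw [hdense]; trivial
    have hpos : 0 < ρ x := by simpa using ht1
    obtain ⟨y, hyΩ, hy1, hy2⟩ := ((mem_closure_iff_frequently.1 hx).and_eventually
      (ht2.and (hρ.1.continuous.continuousAt.eventually (lt_mem_nhds hpos)))).exists
    exact absurd (hy1.1 hyΩ) (not_lt.2 hy2.le)
  · refine ⟨N, θ, h0, hπ, Set.Subset.antisymm (fun x hx => (hA x).2 ?_) hsA⟩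
    rcases lt_trichotomy (inner ℝ (N : Euc (n + 1)) (x : Euc (n + 1))) c with hxc | hxc | hxc
    · exact absurd (subset_closure ((hB x).2 hxc)) (hmeet _ hsB x hx)
    · exact absurd (hAf x hxc).2 (hmeet _ hsB x hx)
    · exact hxc
  · refine ⟨-N, Real.pi - θ, h0', hπ', Set.Subset.antisymm (fun x hx => (hB x).2 ?_) hsB⟩
    rcases lt_trichotomy (inner ℝ (N : Euc (n + 1)) (x : Euc (n + 1))) c with hxc | hxc | hxc
    · exact hxc
    · exact absurd (hAf x hxc).1 (hmeet _ hsA x hx)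
    · exact absurd (subset_closure ((hA x).2 hxc)) (hmeet _ hsA x hx)
  · exfalso
    obtain ⟨x, hx⟩ := hΩ.isConnected.nonempty
    rcases lt_trichotomy (inner ℝ (N : Euc (n + 1)) (x : Euc (n + 1))) c with hxc | hxc | hxc
    · exact hmeet _ hsB x hx (subset_closure ((hB x).2 hxc))
    · exact hmeet _ hsA x hx (hAf x hxc).1
    · exact hmeet _ hsA x hx (subset_closure ((hA x).2 hxc))

/-- From `ν = c q - b`: orthogonality to `q` gives `⟨b, q⟩ = c` and unit length gives `‖b‖² = c² +
1`. Hence `b ≠ 0` and `|c| / ‖b‖ < 1`, so the boundary lies in a genuine small sphere about `b /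
‖b‖`. -/
theorem isSphericalCap_of_isSimpleNonGenericDomain (hn : 2 ≤ n)
    (hΩ : IsSimpleNonGenericDomain (roundMetric n) Ω) : IsSphericalCap Ω := by
  obtain ⟨c, b, hcb⟩ := exists_outwardNormal_eq hn hΩ
  obtain ⟨⟨hdom, -⟩, hconn⟩ := hΩ
  have hν : ∀ q ∈ frontier Ω, ‖outwardNormal Ω q‖ = 1 ∧
      inner ℝ (q : Euc (n + 1)) (outwardNormal Ω q) = (0 : ℝ) := by
    intro q hq
    obtain ⟨ρ, hρ⟩ := hdom.smooth_boundary q hq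
    rw [hρ.outwardNormal_eq]
    exact ⟨hρ.norm_unitGradient, hρ.inner_unitGradient⟩
  have hqb : ∀ q ∈ frontier Ω, inner ℝ b (q : Euc (n + 1)) = c := by
    intro q hq
    have h1 := (hν q hq).2
    rw [hcb q hq, inner_sub_right, inner_smul_right, inner_self_unitSphere, real_inner_comm] at h1
    linarith
  obtain ⟨p, hp⟩ := hconn.nonempty
  have hb : ‖b‖ ^ 2 = c ^ 2 + 1 := by
    have h1 := (hν p hp).1
    have h2 : b = c • (p : Euc (n + 1)) - outwardNormal Ω p := by rw [hcb p hp]; abel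
    rw [h2, @norm_sub_sq ℝ, norm_smul, norm_unitSphere, inner_smul_left, (hν p hp).2, h1,
      mul_one, Real.norm_eq_abs, sq_abs]
    simp
  have hb0 : 0 < ‖b‖ := by
    rcases (norm_nonneg b).eq_or_lt with h | h
    · rw [← h] at hb
      nlinarith [sq_nonneg c]
    · exact h
  have hbne : b ≠ 0 := norm_pos_iff.1 hb0
  refine isSphericalCap_of_frontier_subset hdom hconn.nonempty
    (N := ⟨‖b‖⁻¹ • b, normalize_mem hbne⟩) (c := ‖b‖⁻¹ * c) ?_ fun q hq => ?_
  · rw [← sq_lt_one_iff_abs_lt_one, mul_pow, inv_pow, hb, inv_mul_lt_iff₀ (by positivity)]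
    linarith
  · change inner ℝ (‖b‖⁻¹ • b) (q : Euc (n + 1)) = _
    rw [inner_smul_left, hqb q hq]
    simp

end Global

end StaticDomain

end

/-! ### The classification -/

theorem mainTheorem2 (n : ℕ) (hn : 2 ≤ n) :
    (∀ Ω : Set (StaticDomain.UnitSphere n), StaticDomain.IsSphericalCap Ω →
      StaticDomain.IsNonGenericDomain (StaticDomain.roundMetric n) Ω) ∧
    (∀ θ : ℝ, 0 < θ → θ < Real.pi →
      StaticDomain.kerPhiStar (StaticDomain.roundMetric n)
          (StaticDomain.sphericalCap (StaticDomain.northPole n) θ) =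
        (Submodule.span ℝ (Set.range fun i : Fin n =>
          StaticDomain.coordFun
            (closure (StaticDomain.sphericalCap (StaticDomain.northPole n) θ))
            i.castSucc) :
          Set (closure (StaticDomain.sphericalCap (StaticDomain.northPole n) θ) → ℝ))) ∧
    (∀ Ω : Set (StaticDomain.UnitSphere n),
      StaticDomain.IsSimpleNonGenericDomain (StaticDomain.roundMetric n) Ω ↔
        StaticDomain.IsSphericalCap Ω) := by
  refine ⟨?_, fun θ h0 hπ => StaticDomain.kerPhiStar_sphericalCap_northPole hn h0 hπ, fun Ω =>
    ⟨StaticDomain.isSphericalCap_of_isSimpleNonGenericDomain hn, ?_⟩⟩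
  · rintro _ ⟨N, θ, h0, hπ, rfl⟩
    exact StaticDomain.isNonGenericDomain_sphericalCap hn h0 hπ
  · rintro ⟨N, θ, h0, hπ, rfl⟩
    exact ⟨StaticDomain.isNonGenericDomain_sphericalCap hn h0 hπ,
      StaticDomain.isConnected_frontier_sphericalCap hn h0 hπ⟩
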